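/- Let $\mu$ be a Poisson point process in $\mathbb{R}^2$ of unit intensity (identified with the counting measure of its random set of points). For $R>0$ let $\mathcal F_R$ be the set of smooth functions $\zeta:\mathbb{R}^2\to\mathbb{R}$ with $\operatorname{supp}\zeta\subset(0,R)^2$, $|\nabla\zeta|\le 1$ and $\int_{\mathbb{R}^2}\zeta\,dx=0$. Then there exist universal constants $C>0$ and $R_0<\infty$ such that for all $R\ge R_0$ the random variable $\sup_{\zeta\in\mathcal F_R}\int\zeta\,d\mu$ is almost surely finite and integrable, and $$\mathbb{E}\,\sup\Big\{\int\zeta\,d\mu\ \Big|\ \zeta\ \text{smooth},\ \operatorname{supp}\zeta\subset(0,R)^2,\ |\nabla\zeta|\le 1,\ \int\zeta\,dx=0\Big\}\ \ge\ C\,R^2\,(\ln R)^{1/2}.$$ -/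

import Mathlib

open MeasureTheory ProbabilityTheory
open scoped ENNReal

/-- The plane `ℝ²` with its Euclidean norm and Lebesgue measure. -/
abbrev Plane : Type := EuclideanSpace ℝ (Fin 2)

/-- `μ` is a Poisson point process on `ℝ²` of unit intensity (its intensity measure is Lebesgue
measure), defined on the probability space `(Ω, P)`; the random point set is identified with its
counting measure. -/
structure IsUnitPoissonProcess {Ω : Type*} [MeasurableSpace Ω] (P : Measure Ω)
    (μ : Ω → Measure Plane) : Prop where
  /-- `μ` is a random measure: `ω ↦ μ ω A` is measurable for every Borel set `A`. -/
  measurable : Measurable μ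
  /-- Almost surely, `μ` is the counting measure of a locally finite set of points. -/
  point_set : ∀ᵐ ω ∂P, ∃ X : Set Plane,
    (∀ r : ℝ, (X ∩ Metric.closedBall 0 r).Finite) ∧ μ ω = Measure.count.restrict X
  /-- The number of points in a Borel set of finite area is Poisson distributed, its mean
  being the area. -/
  hasLaw : ∀ A : Set Plane, MeasurableSet A → volume A ≠ ∞ →
    HasLaw (fun ω ↦ μ ω A)
      ((poissonMeasure (volume A).toNNReal).map (Nat.cast : ℕ → ℝ≥0∞)) P
  /-- The numbers of points in pairwise disjoint Borel sets are independent. -/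
  indep : ∀ (n : ℕ) (A : Fin n → Set Plane), (∀ i, MeasurableSet (A i)) →
    (∀ i j, i ≠ j → Disjoint (A i) (A j)) → iIndepFun (fun i ω ↦ μ ω (A i)) P

/-- The open square `(0,R)²`. -/
def openSquare (R : ℝ) : Set Plane := {x | ∀ i, 0 < x i ∧ x i < R}

/-- The competitors: smooth `ζ : ℝ² → ℝ` with `supp ζ ⊂ (0,R)²`, `|∇ζ| ≤ 1` and `∫ ζ dx = 0`. -/
structure IsAdmissible (R : ℝ) (ζ : Plane → ℝ) : Prop where
  smooth : ContDiff ℝ (⊤ : ℕ∞) ζ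
  support_subset : tsupport ζ ⊆ openSquare R
  gradient_le : ∀ x, ‖gradient ζ x‖ ≤ 1
  integral_eq_zero : ∫ x, ζ x = 0

/-- `sup {∫ ζ dν | supp ζ ⊂ (0,R)², |∇ζ| ≤ 1, ∫ ζ dx = 0}`. -/
noncomputable def dualSup (R : ℝ) (ν : Measure Plane) : ℝ :=
  sSup {s : ℝ | ∃ ζ : Plane → ℝ, IsAdmissible R ζ ∧ s = ∫ x, ζ x ∂ν}

/-! Multiscale construction. For a cell of side `ℓ`, let `Y` be the integral against `μ` of a
mean-zero bump of height of order `ℓ` and gradient at most 1. Its variance is of order `ℓ ^ 4`, and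
for `ℓ ≥ 1` one has `E|Y| ≳ ℓ ^ 2`. Choosing the sign of the bump in each cell of a grid on the
square therefore gains order `R ^ 2` at every dyadic scale `ℓ = R / 2 ^ j ≥ 1`, and there are about
`ln R` such scales.

Gradients at different scales are almost orthogonal in `L²`: a fine bump has mean-zero gradient, and
the coarser function has an almost constant gradient on its cell. Hence `r` scales superposed with
amplitude `a = δ / √r` have Dirichlet energy of order `a ^ 2 * r * R ^ 2 = δ ^ 2 * R ^ 2`, while the
gain is of order `a * r * R ^ 2 = δ * √r * R ^ 2`.

The energy bound must be upgraded to the pointwise bound `|∇ζ| ≤ 1`. For this, no bump is added in a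
cell where the current gradient exceeds `1 / 2` somewhere. By Chebyshev such cells cover area at
most a multiple of the energy. Which cells are skipped depends on `μ`, so their loss is bounded
deterministically by Young's inequality, `|Y| ≤ δ / (2ℓ²) * Y² + ℓ² / (2δ)`. The first term is paid
by the second moment, the second by the area of skipped cells; both cost only `O(δ) * R ^ 2` per
scale, so small `δ` leaves a positive gain.

The probabilistic input is the characteristic functional (`integral_exp_setIntegral`), which yields
both moment bounds. The deterministic core is `IsControlled.exists_add_scale`, iterated in
`exists_isControlled`; expectations are taken in `le_integral_dualSup`. -/

namespace IsUnitPoissonProcess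

variable {Ω : Type*} [MeasurableSpace Ω] {P : Measure Ω} {μ : Ω → Measure Plane}

/-! ### Linear statistics of the Poisson process and their characteristic functional -/

lemma measurable_apply (h : IsUnitPoissonProcess P μ) {A : Set Plane} (hA : MeasurableSet A) :
    Measurable fun ω ↦ μ ω A :=
  (Measure.measurable_coe hA).comp h.measurable

lemma lintegral_ne_top (h : IsUnitPoissonProcess P μ) {A : Set Plane} (hA : MeasurableSet A)
    (hv : volume A ≠ ∞) : ∫⁻ ω, μ ω A ∂P ≠ ∞ := by
  have h1 := (h.hasLaw A hA hv).lintegral_comp (f := id) aemeasurable_id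
  simp only [id] at h1
  rw [h1, lintegral_map (f := fun x ↦ x) measurable_id (by fun_prop)]
  have h2 : Integrable (fun n : ℕ ↦ (n : ℝ)) (poissonMeasure (volume A).toNNReal) := by
    rw [integrable_poissonMeasure_iff]
    set r : ℝ := ((volume A).toNNReal : ℝ)
    rw [← summable_nat_add_iff 1]
    have := (Real.summable_pow_div_factorial r).mul_left (Real.exp (-r) * r)
    refine this.congr fun n ↦ ?_
    have : (n.factorial : ℝ) ≠ 0 := by positivity
    have h3 : ((n : ℝ) + 1) ≠ 0 := by positivity
    rw [Nat.factorial_succ, Real.norm_of_nonneg (by positivity)]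
    push_cast
    field_simp
    ring
  have h3 := h2.2.ne
  simpa [enorm] using h3

lemma ae_lt_top (h : IsUnitPoissonProcess P μ) {A : Set Plane} (hA : MeasurableSet A)
    (hv : volume A ≠ ∞) : ∀ᵐ ω ∂P, μ ω A < ∞ :=
  MeasureTheory.ae_lt_top (h.measurable_apply hA) (h.lintegral_ne_top hA hv)

lemma integrable_toReal (h : IsUnitPoissonProcess P μ) {A : Set Plane} (hA : MeasurableSet A)
    (hv : volume A ≠ ∞) : Integrable (fun ω ↦ (μ ω A).toReal) P :=
  integrable_toReal_of_lintegral_ne_top (h.measurable_apply hA).aemeasurable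
    (h.lintegral_ne_top hA hv)

lemma integral_exp_mul_count (h : IsUnitPoissonProcess P μ) {A : Set Plane}
    (hA : MeasurableSet A) (hv : volume A ≠ ∞) (c : ℝ) :
    ∫ ω, Complex.exp ((c * (μ ω A).toReal : ℝ) * Complex.I) ∂P =
      Complex.exp ((volume A).toReal * (Complex.exp (c * Complex.I) - 1)) := by
  have h1 := (h.hasLaw A hA hv).integral_comp
    (f := fun x : ℝ≥0∞ ↦ Complex.exp ((c * x.toReal : ℝ) * Complex.I))
    (by fun_prop)
  rw [Function.comp_def] at h1
  rw [h1, integral_map (by fun_prop) (by fun_prop)]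
  have h2 := charFun_map_cast_poissonMeasure (volume A).toNNReal c
  rw [charFun_apply, integral_map .of_discrete (by fun_prop)] at h2
  simp only [Real.inner_apply] at h2
  simp only [ENNReal.toReal_natCast]
  rw [show ((volume A).toReal : ℂ) = (((volume A).toNNReal : ℝ) : ℂ) from rfl, ← h2]
  simp only [mul_comm]

/-- Counts in disjoint sets are independent, so the characteristic functions multiply. The
enumeration of `s` is needed because independence is assumed for families indexed by `Fin n`. -/
lemma integral_exp_sum_count [IsProbabilityMeasure P] (h : IsUnitPoissonProcess P μ) {ι : Type*}
    (s : Finset ι) {A : ι → Set Plane}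
    (hA : ∀ i, MeasurableSet (A i)) (hv : ∀ i, volume (A i) ≠ ∞)
    (hd : Pairwise (Function.onFun Disjoint A)) (c : ι → ℝ) :
    ∫ ω, Complex.exp ((∑ i ∈ s, c i * (μ ω (A i)).toReal : ℝ) * Complex.I) ∂P =
      Complex.exp (∑ i ∈ s, (volume (A i)).toReal * (Complex.exp (c i * Complex.I) - 1)) := by
  have hind := h.indep s.card (fun j ↦ A (s.equivFin.symm j)) (fun j ↦ hA _) (fun i j hij ↦
    hd (fun e ↦ hij (s.equivFin.symm.injective (Subtype.ext e))))
  have h1 := hind.integral_fun_prod_comp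
    (f := fun j x ↦ Complex.exp ((c (s.equivFin.symm j) * x.toReal : ℝ) * Complex.I))
    (fun i ↦ (h.measurable_apply (hA _)).aemeasurable) (fun i ↦ by fun_prop)
  simp only [h.integral_exp_mul_count (hA _) (hv _)] at h1
  rw [Complex.exp_sum, ← Finset.prod_coe_sort, ← Equiv.prod_comp s.equivFin.symm, ← h1]
  refine integral_congr_ae (.of_forall fun ω ↦ ?_)
  simp only
  rw [← Complex.exp_sum, ← Finset.sum_mul, ← Finset.sum_coe_sort,
    ← Equiv.sum_comp s.equivFin.symm, Complex.ofReal_sum]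

/-- The level sets of `f` inside `Q` are disjoint, so the integral is a finite combination of
independent counts. General bounded `f` then follows by dominated convergence. -/
lemma integral_exp_simpleFunc [IsProbabilityMeasure P] (h : IsUnitPoissonProcess P μ)
    {Q : Set Plane} (hQ : MeasurableSet Q) (hv : volume Q ≠ ∞) (f : SimpleFunc Plane ℝ) :
    ∫ ω, Complex.exp ((∫ x in Q, f x ∂(μ ω) : ℝ) * Complex.I) ∂P =
      Complex.exp (∫ x in Q, (Complex.exp (f x * Complex.I) - 1)) := by
  have hfin : IsFiniteMeasure (volume.restrict Q) := ⟨by simpa using hv.lt_top⟩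
  have h1 := h.integral_exp_sum_count f.range (A := fun y ↦ f ⁻¹' {y} ∩ Q)
    (fun y ↦ (f.measurableSet_fiber y).inter hQ)
    (fun y ↦ ((measure_mono Set.inter_subset_right).trans_lt hv.lt_top).ne)
    (fun y z hyz ↦ (Disjoint.preimage f (by simpa using hyz)).mono
      Set.inter_subset_left Set.inter_subset_left) id
  simp only [id] at h1
  have h2 : ∫ x in Q, (Complex.exp (f x * Complex.I) - 1) =
      ∑ y ∈ f.range, (volume (f ⁻¹' {y} ∩ Q)).toReal * (Complex.exp (y * Complex.I) - 1) := by
    have h3 := SimpleFunc.map_integral (μ := volume.restrict Q) f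
      (fun y : ℝ ↦ Complex.exp (y * Complex.I) - 1) (f.integrable_of_isFiniteMeasure) (by simp)
    rw [SimpleFunc.integral_eq_integral _ (SimpleFunc.integrable_of_isFiniteMeasure _)] at h3
    simp only [SimpleFunc.coe_map, Function.comp_apply] at h3
    rw [h3]
    refine Finset.sum_congr rfl fun y _ ↦ ?_
    rw [Measure.real, Measure.restrict_apply (f.measurableSet_fiber y)]
    simp
  rw [h2, ← h1]
  refine integral_congr_ae ?_
  filter_upwards [h.ae_lt_top hQ hv] with ω hω
  have : IsFiniteMeasure ((μ ω).restrict Q) := ⟨by simpa using hω⟩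
  rw [SimpleFunc.integral_eq_sum _ (SimpleFunc.integrable_of_isFiniteMeasure _)]
  congr 3
  refine Finset.sum_congr rfl fun y _ ↦ ?_
  rw [Measure.real, Measure.restrict_apply (f.measurableSet_fiber y)]
  simp [mul_comm]

lemma aemeasurable_setIntegral_simpleFunc (h : IsUnitPoissonProcess P μ)
    {Q : Set Plane} (hQ : MeasurableSet Q) (hv : volume Q ≠ ∞) (f : SimpleFunc Plane ℝ) :
    AEMeasurable (fun ω ↦ ∫ x in Q, f x ∂(μ ω)) P := by
  have h1 : Measurable fun ω ↦ ∑ y ∈ f.range, (μ ω (f ⁻¹' {y} ∩ Q)).toReal * y :=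
    Finset.measurable_sum _ fun y _ ↦
      (h.measurable_apply ((f.measurableSet_fiber y).inter hQ)).ennreal_toReal.mul_const y
  refine h1.aemeasurable.congr ?_
  filter_upwards [h.ae_lt_top hQ hv] with ω hω
  have : IsFiniteMeasure ((μ ω).restrict Q) := ⟨by simpa using hω⟩
  rw [SimpleFunc.integral_eq_sum _ (SimpleFunc.integrable_of_isFiniteMeasure _)]
  refine Finset.sum_congr rfl fun y _ ↦ ?_
  rw [Measure.real, Measure.restrict_apply (f.measurableSet_fiber y)]
  simp

lemma tendsto_setIntegral_approxBounded (h : IsUnitPoissonProcess P μ)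
    {Q : Set Plane} (hQ : MeasurableSet Q) (hv : volume Q ≠ ∞) {f : Plane → ℝ}
    (hf : StronglyMeasurable f) {M : ℝ} (hM : ∀ x, ‖f x‖ ≤ M) :
    ∀ᵐ ω ∂P, Filter.Tendsto (fun n ↦ ∫ x in Q, hf.approxBounded M n x ∂(μ ω)) Filter.atTop
      (nhds (∫ x in Q, f x ∂(μ ω))) := by
  have hM0 : 0 ≤ M := (norm_nonneg _).trans (hM 0)
  filter_upwards [h.ae_lt_top hQ hv] with ω hω
  have : IsFiniteMeasure ((μ ω).restrict Q) := ⟨by simpa using hω⟩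
  refine tendsto_integral_of_dominated_convergence (fun _ ↦ M)
    (fun n ↦ (hf.approxBounded M n).aestronglyMeasurable) (integrable_const M)
    (fun n ↦ .of_forall fun x ↦ hf.norm_approxBounded_le hM0 n x)
    (.of_forall fun x ↦ hf.tendsto_approxBounded_of_norm_le (hM x))

lemma aemeasurable_setIntegral (h : IsUnitPoissonProcess P μ)
    {Q : Set Plane} (hQ : MeasurableSet Q) (hv : volume Q ≠ ∞) {f : Plane → ℝ}
    (hf : StronglyMeasurable f) {M : ℝ} (hM : ∀ x, ‖f x‖ ≤ M) :
    AEMeasurable (fun ω ↦ ∫ x in Q, f x ∂(μ ω)) P :=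
  aemeasurable_of_tendsto_metrizable_ae Filter.atTop
    (fun n ↦ h.aemeasurable_setIntegral_simpleFunc hQ hv (hf.approxBounded M n))
    (h.tendsto_setIntegral_approxBounded hQ hv hf hM)

/-- The characteristic functional of the Poisson process. -/
lemma integral_exp_setIntegral [IsProbabilityMeasure P] (h : IsUnitPoissonProcess P μ)
    {Q : Set Plane} (hQ : MeasurableSet Q) (hv : volume Q ≠ ∞) {f : Plane → ℝ}
    (hf : StronglyMeasurable f) {M : ℝ} (hM : ∀ x, ‖f x‖ ≤ M) :
    ∫ ω, Complex.exp ((∫ x in Q, f x ∂(μ ω) : ℝ) * Complex.I) ∂P =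
      Complex.exp (∫ x in Q, (Complex.exp (f x * Complex.I) - 1)) := by
  have hfin : IsFiniteMeasure (volume.restrict Q) := ⟨by simpa using hv.lt_top⟩
  have hl : Filter.Tendsto
      (fun n ↦ ∫ ω, Complex.exp ((∫ x in Q, hf.approxBounded M n x ∂(μ ω) : ℝ) * Complex.I) ∂P)
      Filter.atTop
      (nhds (∫ ω, Complex.exp ((∫ x in Q, f x ∂(μ ω) : ℝ) * Complex.I) ∂P)) := by
    refine tendsto_integral_of_dominated_convergence (fun _ ↦ 1) (fun n ↦ ?_)
      (integrable_const 1) (fun n ↦ .of_forall fun x ↦ (Complex.norm_exp_ofReal_mul_I _).le) ?_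
    · have := h.aemeasurable_setIntegral_simpleFunc hQ hv (hf.approxBounded M n)
      exact (Complex.measurable_exp.comp_aemeasurable
        ((Complex.measurable_ofReal.comp_aemeasurable this).mul_const _)).aestronglyMeasurable
    · filter_upwards [h.tendsto_setIntegral_approxBounded hQ hv hf hM] with ω hω
      exact (Complex.continuous_exp.tendsto _).comp
        (((Complex.continuous_ofReal.tendsto _).comp hω).mul_const _)
  have hr : Filter.Tendsto
      (fun n ↦ Complex.exp (∫ x in Q, (Complex.exp (hf.approxBounded M n x * Complex.I) - 1)))
      Filter.atTop (nhds (Complex.exp (∫ x in Q, (Complex.exp (f x * Complex.I) - 1)))) := by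
    refine (Complex.continuous_exp.tendsto _).comp ?_
    refine tendsto_integral_of_dominated_convergence (fun _ ↦ 2) (fun n ↦ ?_)
      (integrable_const 2) (fun n ↦ .of_forall fun x ↦ ?_) (.of_forall fun x ↦ ?_)
    · exact (((Complex.measurable_exp.comp ((Complex.measurable_ofReal.comp
        (hf.approxBounded M n).measurable).mul_const _)).sub_const 1)).aestronglyMeasurable
    · refine (norm_sub_le _ _).trans ?_
      rw [Complex.norm_exp_ofReal_mul_I]
      norm_num
    · refine Filter.Tendsto.sub_const ((Complex.continuous_exp.tendsto _).comp
        (((Complex.continuous_ofReal.tendsto _).comp ?_).mul_const _)) _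
      exact hf.tendsto_approxBounded_of_norm_le (hM x)
  refine tendsto_nhds_unique hl (hr.congr fun n ↦ ?_)
  exact (h.integral_exp_simpleFunc hQ hv _).symm

end IsUnitPoissonProcess

/-! ### First and second moment bounds from the characteristic functional -/

namespace IsUnitPoissonProcess

variable {Ω : Type*} [MeasurableSpace Ω] {P : Measure Ω} {μ : Ω → Measure Plane}

lemma integrable_setIntegral (h : IsUnitPoissonProcess P μ)
    {Q : Set Plane} (hQ : MeasurableSet Q) (hv : volume Q ≠ ∞) {f : Plane → ℝ}
    (hf : StronglyMeasurable f) {M : ℝ} (hM : ∀ x, ‖f x‖ ≤ M) :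
    Integrable (fun ω ↦ ∫ x in Q, f x ∂(μ ω)) P := by
  refine ((h.integrable_toReal hQ hv).const_mul M).mono'
    (h.aemeasurable_setIntegral hQ hv hf hM).aestronglyMeasurable ?_
  filter_upwards [h.ae_lt_top hQ hv] with ω hω
  exact norm_setIntegral_le_of_norm_le_const hω (fun x _ ↦ hM x)

/-- With `Y` the linear statistic, `|e^{isY} - 1| ≤ s|Y|` gives `1 - |E e^{isY}| ≤ s E|Y|`, and the
modulus of the characteristic functional is the exponential of the real part of its exponent. This
bounds `E|Y|` from below without fourth moments. -/
lemma one_sub_exp_le_mul_integral_abs [IsProbabilityMeasure P] (h : IsUnitPoissonProcess P μ)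
    {Q : Set Plane} (hQ : MeasurableSet Q) (hv : volume Q ≠ ∞) {f : Plane → ℝ}
    (hf : StronglyMeasurable f) {M : ℝ} (hM : ∀ x, ‖f x‖ ≤ M) {s : ℝ} (hs : 0 ≤ s) :
    1 - Real.exp (-∫ x in Q, (1 - Real.cos (s * f x))) ≤
      s * ∫ ω, |∫ x in Q, f x ∂(μ ω)| ∂P := by
  have hfin : IsFiniteMeasure (volume.restrict Q) := ⟨by simpa using hv.lt_top⟩
  have hY := h.integrable_setIntegral hQ hv hf hM
  have hχ := h.integral_exp_setIntegral hQ hv (hf.const_mul s) (M := s * M) (fun x ↦ by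
    rw [norm_mul, Real.norm_of_nonneg hs]; exact mul_le_mul_of_nonneg_left (hM x) hs)
  simp only [integral_const_mul] at hχ
  have hint : Integrable (fun x ↦ Complex.exp ((s * f x : ℝ) * Complex.I) - 1)
      (volume.restrict Q) := by
    refine .of_bound (C := 2) (((Complex.measurable_exp.comp ((Complex.measurable_ofReal.comp
        (hf.measurable.const_mul s)).mul_const _)).sub_const 1)).aestronglyMeasurable
        (.of_forall fun x ↦ ?_)
    refine (norm_sub_le _ _).trans ?_
    rw [Complex.norm_exp_ofReal_mul_I]
    norm_num
  have hnorm : ‖Complex.exp (∫ x in Q, (Complex.exp ((s * f x : ℝ) * Complex.I) - 1))‖ =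
      Real.exp (-∫ x in Q, (1 - Real.cos (s * f x))) := by
    rw [Complex.norm_exp, ← integral_neg]
    have := integral_re (𝕜 := ℂ) hint
    simp only [RCLike.re_to_complex] at this
    rw [← this]
    congr 2
    ext x
    rw [Complex.sub_re, Complex.exp_ofReal_mul_I_re]
    simp
  rw [← hnorm, ← hχ, ← integral_const_mul]
  have hY' : AEStronglyMeasurable (fun ω ↦
      Complex.exp ((s * ∫ x in Q, f x ∂(μ ω) : ℝ) * Complex.I)) P :=
    (Complex.measurable_exp.comp_aemeasurable ((Complex.measurable_ofReal.comp_aemeasurable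
      (hY.aemeasurable.const_mul s)).mul_const _)).aestronglyMeasurable
  have hYi : Integrable (fun ω ↦
      Complex.exp ((s * ∫ x in Q, f x ∂(μ ω) : ℝ) * Complex.I)) P :=
    .of_bound (C := 1) hY' (.of_forall fun x ↦ (Complex.norm_exp_ofReal_mul_I _).le)
  calc _ ≤ ‖(1 : ℂ) - ∫ ω, Complex.exp ((s * ∫ x in Q, f x ∂(μ ω) : ℝ) * Complex.I) ∂P‖ := by
        refine le_trans ?_ (norm_sub_norm_le _ _)
        simp
    _ = ‖∫ ω, (Complex.exp (Complex.I * (s * ∫ x in Q, f x ∂(μ ω) : ℝ)) - 1) ∂P‖ := by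
        rw [norm_sub_rev, integral_sub (by simpa only [mul_comm] using hYi) (integrable_const _)]
        simp [mul_comm]
    _ ≤ ∫ ω, s * |∫ x in Q, f x ∂(μ ω)| ∂P := by
        refine norm_integral_le_of_norm_le (hY.abs.const_mul s) (.of_forall fun ω ↦ ?_)
        refine Real.norm_exp_I_mul_ofReal_sub_one_le.trans ?_
        rw [norm_mul, Real.norm_of_nonneg hs, Real.norm_eq_abs]

/-- The left side is the real part of `1 - e^z`, with `z` the exponent of the characteristic
functional. Since `f` has mean zero, the linear term of `z` drops out and `|z|` is at most `s ^ 2 *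
∫ f ^ 2`; the smallness conditions on `s` are those of the two elementary exponential estimates. -/
lemma integral_one_sub_cos_le [IsProbabilityMeasure P] (h : IsUnitPoissonProcess P μ)
    {Q : Set Plane} (hQ : MeasurableSet Q) (hv : volume Q ≠ ∞) {f : Plane → ℝ}
    (hf : StronglyMeasurable f) {M : ℝ} (hM : ∀ x, ‖f x‖ ≤ M) (h0 : ∫ x in Q, f x = 0) {s : ℝ}
    (hs : 0 ≤ s) (hsM : s * M ≤ 1) (hs1 : s ^ 2 * ∫ x in Q, f x ^ 2 ≤ 1) :
    ∫ ω, (1 - Real.cos (s * ∫ x in Q, f x ∂(μ ω))) ∂P ≤ 2 * s ^ 2 * ∫ x in Q, f x ^ 2 := by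
  have hfin : IsFiniteMeasure (volume.restrict Q) := ⟨by simpa using hv.lt_top⟩
  have hY := h.integrable_setIntegral hQ hv hf hM
  have hχ := h.integral_exp_setIntegral hQ hv (hf.const_mul s) (M := s * M) (fun x ↦ by
    rw [norm_mul, Real.norm_of_nonneg hs]; exact mul_le_mul_of_nonneg_left (hM x) hs)
  simp only [integral_const_mul] at hχ
  have hfi : Integrable f (volume.restrict Q) :=
    .of_bound hf.aestronglyMeasurable M (.of_forall hM)
  have hf2 : Integrable (fun x ↦ f x ^ 2) (volume.restrict Q) :=
    .of_bound (hf.pow 2).aestronglyMeasurable (M ^ 2) (.of_forall fun x ↦ by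
      rw [norm_pow]; exact pow_le_pow_left₀ (norm_nonneg _) (hM x) 2)
  have hint : Integrable (fun x ↦ Complex.exp ((s * f x : ℝ) * Complex.I) - 1)
      (volume.restrict Q) := by
    refine .of_bound (C := 2) (((Complex.measurable_exp.comp ((Complex.measurable_ofReal.comp
        (hf.measurable.const_mul s)).mul_const _)).sub_const 1)).aestronglyMeasurable
        (.of_forall fun x ↦ ?_)
    refine (norm_sub_le _ _).trans ?_
    rw [Complex.norm_exp_ofReal_mul_I]
    norm_num
  set z : ℂ := ∫ x in Q, (Complex.exp ((s * f x : ℝ) * Complex.I) - 1) with hz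
  have hz' : z = ∫ x in Q,
      (Complex.exp ((s * f x : ℝ) * Complex.I) - 1 - (s * f x : ℝ) * Complex.I) := by
    have hfi' : Integrable (fun x ↦ ((s * f x : ℝ) : ℂ) * Complex.I) (volume.restrict Q) :=
      (hfi.const_mul s).ofReal.mul_const _
    rw [integral_sub hint hfi', integral_mul_const,
      integral_complex_ofReal, integral_const_mul, h0]
    simp [hz]
  have hzn : ‖z‖ ≤ s ^ 2 * ∫ x in Q, f x ^ 2 := by
    rw [hz', ← integral_const_mul]
    refine norm_integral_le_of_norm_le (hf2.const_mul _) (.of_forall fun x ↦ ?_)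
    have hn : ‖((s * f x : ℝ) : ℂ) * Complex.I‖ = s * ‖f x‖ := by
      rw [norm_mul, Complex.norm_I, mul_one, Complex.norm_real, norm_mul, Real.norm_of_nonneg hs]
    refine (Complex.norm_exp_sub_one_sub_id_le ?_).trans ?_
    · rw [hn]; exact (mul_le_mul_of_nonneg_left (hM x) hs).trans hsM
    · rw [hn, mul_pow, Real.norm_eq_abs, sq_abs]
  have hYi : Integrable (fun ω ↦
      Complex.exp ((s * ∫ x in Q, f x ∂(μ ω) : ℝ) * Complex.I)) P :=
    .of_bound (C := 1) (Complex.measurable_exp.comp_aemeasurable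
      ((Complex.measurable_ofReal.comp_aemeasurable
      (hY.aemeasurable.const_mul s)).mul_const _)).aestronglyMeasurable
      (.of_forall fun x ↦ (Complex.norm_exp_ofReal_mul_I _).le)
  have hre := integral_re (𝕜 := ℂ) hYi
  simp only [RCLike.re_to_complex, Complex.exp_ofReal_mul_I_re] at hre
  have hYr := hYi.re
  simp only [RCLike.re_to_complex, Complex.exp_ofReal_mul_I_re] at hYr
  rw [integral_sub (integrable_const _) hYr, hre, hχ]
  calc _ = -(Complex.exp z - 1).re := by simp
    _ ≤ ‖Complex.exp z - 1‖ := (neg_le_abs _).trans (Complex.abs_re_le_norm _)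
    _ ≤ 2 * ‖z‖ := Complex.norm_exp_sub_one_le (hzn.trans hs1)
    _ ≤ _ := by rw [mul_assoc]; gcongr

/-- Once `|sY| ≤ π`, `Y²` is at most `π² / (2s²) * (1 - cos (sY))`. Letting `s → 0`, Fatou's lemma
transfers the preceding bound to the second moment. The factor `π²` is not sharp, but any constant
suffices. -/
lemma lintegral_sq_le [IsProbabilityMeasure P] (h : IsUnitPoissonProcess P μ)
    {Q : Set Plane} (hQ : MeasurableSet Q) (hv : volume Q ≠ ∞) {f : Plane → ℝ}
    (hf : StronglyMeasurable f) {M : ℝ} (hM : ∀ x, ‖f x‖ ≤ M) (h0 : ∫ x in Q, f x = 0) :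
    ∫⁻ ω, ENNReal.ofReal ((∫ x in Q, f x ∂(μ ω)) ^ 2) ∂P ≤
      ENNReal.ofReal (Real.pi ^ 2 * ∫ x in Q, f x ^ 2) := by
  have hY := h.integrable_setIntegral hQ hv hf hM
  set Y : Ω → ℝ := fun ω ↦ ∫ x in Q, f x ∂(μ ω) with hYdef
  set V : ℝ := ∫ x in Q, f x ^ 2
  let s : ℕ → ℝ := fun n ↦ 1 / ((n : ℝ) + 1)
  have hs0 : Filter.Tendsto s Filter.atTop (nhds 0) := tendsto_one_div_add_atTop_nhds_zero_nat
  have hspos : ∀ n, 0 < s n := fun n ↦ by positivity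
  let g : ℕ → Ω → ℝ := fun n ω ↦ Real.pi ^ 2 / (2 * s n ^ 2) * (1 - Real.cos (s n * Y ω))
  have hgm : ∀ n, AEMeasurable (fun ω ↦ ENNReal.ofReal (g n ω)) P := fun n ↦ by
    have := hY.aemeasurable
    fun_prop
  have hgi : ∀ n, Integrable (g n) P := fun n ↦ by
    have := hY.aemeasurable
    refine Integrable.const_mul (.of_bound (C := 2) ?_ (.of_forall fun ω ↦ ?_)) _
    · exact (by fun_prop : AEMeasurable (fun ω ↦ 1 - Real.cos (s n * Y ω)) P).aestronglyMeasurable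
    · rw [Real.norm_eq_abs, abs_le]
      constructor <;> linarith [Real.cos_le_one (s n * Y ω), Real.neg_one_le_cos (s n * Y ω)]
  have hg0 : ∀ n ω, 0 ≤ g n ω := fun n ω ↦
    mul_nonneg (by positivity) (by linarith [Real.cos_le_one (s n * Y ω)])
  calc _ ≤ ∫⁻ ω, Filter.liminf (fun n ↦ ENNReal.ofReal (g n ω)) Filter.atTop ∂P := by
        refine lintegral_mono fun ω ↦ Filter.le_liminf_of_le (by isBoundedDefault) ?_
        have h1 : Filter.Tendsto (fun n ↦ |s n * Y ω|) Filter.atTop (nhds 0) := by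
          simpa using (hs0.mul_const (Y ω)).abs
        filter_upwards [h1.eventually (ge_mem_nhds Real.pi_pos)] with n hn
        refine ENNReal.ofReal_le_ofReal ?_
        have h2 := Real.cos_le_one_sub_mul_cos_sq hn
        have h3 : 2 / Real.pi ^ 2 * (s n * Y ω) ^ 2 ≤ 1 - Real.cos (s n * Y ω) := by linarith
        have h4 := hspos n
        calc Y ω ^ 2 = Real.pi ^ 2 / (2 * s n ^ 2) * (2 / Real.pi ^ 2 * (s n * Y ω) ^ 2) := by
              have := Real.pi_pos
              field_simp
          _ ≤ _ := mul_le_mul_of_nonneg_left h3 (by positivity)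
    _ ≤ Filter.liminf (fun n ↦ ∫⁻ ω, ENNReal.ofReal (g n ω) ∂P) Filter.atTop :=
        lintegral_liminf_le' hgm
    _ ≤ ENNReal.ofReal (Real.pi ^ 2 * V) := by
        refine Filter.liminf_le_of_frequently_le' (Filter.Eventually.frequently ?_)
        have h1 : Filter.Tendsto (fun n ↦ s n * M) Filter.atTop (nhds 0) := by
          simpa using hs0.mul_const M
        have h2 : Filter.Tendsto (fun n ↦ s n ^ 2 * V) Filter.atTop (nhds 0) := by
          simpa using (hs0.pow 2).mul_const V
        filter_upwards [h1.eventually (ge_mem_nhds one_pos), h2.eventually (ge_mem_nhds one_pos)]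
          with n hn1 hn2
        rw [← ofReal_integral_eq_lintegral_ofReal (hgi n) (.of_forall (hg0 n))]
        refine ENNReal.ofReal_le_ofReal ?_
        have h3 := h.integral_one_sub_cos_le hQ hv hf hM h0 (hspos n).le hn1 hn2
        rw [integral_const_mul]
        have h4 := hspos n
        calc _ ≤ Real.pi ^ 2 / (2 * s n ^ 2) * (2 * s n ^ 2 * V) := by gcongr
          _ = _ := by field_simp

lemma integral_sq_le [IsProbabilityMeasure P] (h : IsUnitPoissonProcess P μ)
    {Q : Set Plane} (hQ : MeasurableSet Q) (hv : volume Q ≠ ∞) {f : Plane → ℝ}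
    (hf : StronglyMeasurable f) {M : ℝ} (hM : ∀ x, ‖f x‖ ≤ M) (h0 : ∫ x in Q, f x = 0) :
    Integrable (fun ω ↦ (∫ x in Q, f x ∂(μ ω)) ^ 2) P ∧
      ∫ ω, (∫ x in Q, f x ∂(μ ω)) ^ 2 ∂P ≤ Real.pi ^ 2 * ∫ x in Q, f x ^ 2 := by
  have hY := h.integrable_setIntegral hQ hv hf hM
  have h1 := h.lintegral_sq_le hQ hv hf hM h0
  have hm : AEStronglyMeasurable (fun ω ↦ (∫ x in Q, f x ∂(μ ω)) ^ 2) P :=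
    hY.aestronglyMeasurable.pow 2
  refine ⟨⟨hm, ?_⟩, ?_⟩
  · rw [hasFiniteIntegral_iff_ofReal (.of_forall fun ω ↦ sq_nonneg _)]
    exact h1.trans_lt ENNReal.ofReal_lt_top
  · rw [integral_eq_lintegral_of_nonneg_ae (.of_forall fun ω ↦ sq_nonneg _) hm]
    refine ENNReal.toReal_le_of_le_ofReal ?_ h1
    exact mul_nonneg (by positivity) (integral_nonneg fun x ↦ sq_nonneg _)

end IsUnitPoissonProcess

/-! ### Boxes, admissible functions, and integrability of the supremum -/

/-- The open box `∏ (a c, b c)`. -/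
def openBox (a b : Fin 2 → ℝ) : Set Plane := {x | ∀ c, a c < x c ∧ x c < b c}

lemma openSquare_eq_openBox (R : ℝ) : openSquare R = openBox (fun _ ↦ 0) (fun _ ↦ R) := rfl

lemma openBox_eq_preimage (a b : Fin 2 → ℝ) :
    openBox a b = (WithLp.ofLp : Plane → (Fin 2 → ℝ)) ⁻¹'
      (Set.univ.pi fun c ↦ Set.Ioo (a c) (b c)) := by
  ext x
  simp [openBox]

lemma isOpen_openBox (a b : Fin 2 → ℝ) : IsOpen (openBox a b) := by
  rw [openBox_eq_preimage]
  exact (isOpen_set_pi Set.finite_univ fun c _ ↦ isOpen_Ioo).preimage (PiLp.continuous_ofLp 2 _)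

lemma measurableSet_openBox (a b : Fin 2 → ℝ) : MeasurableSet (openBox a b) :=
  (isOpen_openBox a b).measurableSet

lemma volume_openBox (a b : Fin 2 → ℝ) :
    volume (openBox a b) = ENNReal.ofReal (b 0 - a 0) * ENNReal.ofReal (b 1 - a 1) := by
  rw [openBox_eq_preimage, (PiLp.volume_preserving_ofLp (Fin 2)).measure_preimage
    (MeasurableSet.univ_pi fun c ↦ measurableSet_Ioo).nullMeasurableSet, Real.volume_pi_Ioo,
    Fin.prod_univ_two]

lemma volume_openBox_ne_top (a b : Fin 2 → ℝ) : volume (openBox a b) ≠ ∞ := by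
  rw [volume_openBox]
  exact ENNReal.mul_ne_top ENNReal.ofReal_ne_top ENNReal.ofReal_ne_top

lemma norm_le_two_mul {x : Plane} {r : ℝ} (h : ∀ c, |x c| ≤ r) : ‖x‖ ≤ 2 * r := by
  have h0 := h 0
  have h1 := h 1
  have hr : 0 ≤ r := (abs_nonneg _).trans h0
  rw [EuclideanSpace.norm_eq, Fin.sum_univ_two]
  refine Real.sqrt_le_iff.2 ⟨by positivity, ?_⟩
  simp only [Real.norm_eq_abs]
  nlinarith [pow_le_pow_left₀ (abs_nonneg _) h0 2, pow_le_pow_left₀ (abs_nonneg _) h1 2]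

namespace IsAdmissible

variable {R : ℝ} {ζ : Plane → ℝ}

lemma eq_zero (h : IsAdmissible R ζ) {x : Plane} (hx : x ∉ openSquare R) : ζ x = 0 :=
  image_eq_zero_of_notMem_tsupport fun hx' ↦ hx (h.support_subset hx')

/-- The origin lies outside the open square, so `ζ` vanishes there, and `ζ` is 1-Lipschitz. -/
lemma norm_le (h : IsAdmissible R ζ) (x : Plane) : ‖ζ x‖ ≤ 2 * |R| := by
  by_cases hx : x ∈ openSquare R
  · have h0 : ζ 0 = 0 := h.eq_zero (by simp [openSquare])
    have h1 := Convex.norm_image_sub_le_of_norm_fderiv_le (𝕜 := ℝ) (f := ζ) (C := 1)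
      (fun y _ ↦ (h.smooth.differentiable (by simp)) y)
      (fun y _ ↦ by
        have := h.gradient_le y
        rwa [gradient, LinearIsometryEquiv.norm_map] at this)
      convex_univ (Set.mem_univ 0) (Set.mem_univ x)
    rw [h0, sub_zero, sub_zero, one_mul] at h1
    refine h1.trans (norm_le_two_mul fun c ↦ ?_)
    rw [abs_of_pos (hx c).1]
    exact (hx c).2.le.trans (le_abs_self R)
  · rw [h.eq_zero hx]
    simp

lemma zero : IsAdmissible R 0 where
  smooth := contDiff_const
  support_subset := by simp [tsupport]
  gradient_le x := by
    have : gradient (0 : Plane → ℝ) x = 0 := gradient_const x 0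
    simp [this]
  integral_eq_zero := by simp

lemma setIntegral_eq (h : IsAdmissible R ζ) (ν : Measure Plane) :
    ∫ x in openSquare R, ζ x ∂ν = ∫ x, ζ x ∂ν :=
  setIntegral_eq_integral_of_forall_compl_eq_zero fun _ hx ↦ h.eq_zero hx

lemma abs_integral_le (h : IsAdmissible R ζ) {ν : Measure Plane} (hν : ν (openSquare R) < ∞) :
    |∫ x, ζ x ∂ν| ≤ 2 * |R| * (ν (openSquare R)).toReal := by
  rw [← h.setIntegral_eq, ← Real.norm_eq_abs]
  exact norm_setIntegral_le_of_norm_le_const hν fun x _ ↦ h.norm_le x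

end IsAdmissible

lemma bddAbove_admissible {R : ℝ} {ν : Measure Plane} (hν : ν (openSquare R) < ∞) :
    BddAbove {s : ℝ | ∃ ζ : Plane → ℝ, IsAdmissible R ζ ∧ s = ∫ x, ζ x ∂ν} := by
  refine ⟨2 * |R| * (ν (openSquare R)).toReal, ?_⟩
  rintro _ ⟨ζ, hζ, rfl⟩
  exact (le_abs_self _).trans (hζ.abs_integral_le hν)

lemma IsAdmissible.integral_le_dualSup {R : ℝ} {ζ : Plane → ℝ} (h : IsAdmissible R ζ)
    {ν : Measure Plane} (hν : ν (openSquare R) < ∞) : ∫ x, ζ x ∂ν ≤ dualSup R ν :=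
  le_csSup (bddAbove_admissible hν) ⟨ζ, h, rfl⟩

lemma abs_dualSup_le {R : ℝ} {ν : Measure Plane} (hν : ν (openSquare R) < ∞) :
    |dualSup R ν| ≤ 2 * |R| * (ν (openSquare R)).toReal := by
  rw [abs_of_nonneg (by simpa using IsAdmissible.zero.integral_le_dualSup hν)]
  refine csSup_le ⟨0, 0, .zero, by simp⟩ ?_
  rintro _ ⟨ζ, hζ, rfl⟩
  exact (le_abs_self _).trans (hζ.abs_integral_le hν)

/-- The supremum is attained along a fixed sequence of admissible functions. -/
lemma exists_seq_dualSup_eq_iSup (R : ℝ) : ∃ z : ℕ → Plane → ℝ, (∀ n, IsAdmissible R (z n)) ∧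
    ∀ ν : Measure Plane, ν (openSquare R) < ∞ → dualSup R ν = ⨆ n, ∫ x, z n x ∂ν := by
  -- In the compact-open topology `C(Plane, ℝ)` is second countable, so a countable dense set of
  -- admissible functions exists. Reducing to it makes the supremum measurable up to null sets.
  let S : Set C(Plane, ℝ) := {f | IsAdmissible R f}
  obtain ⟨D, hDS, hDc, hSD⟩ :=
    (TopologicalSpace.IsSeparable.of_separableSpace S).exists_countable_dense_subset
  have hne : D.Nonempty := by
    rw [← closure_nonempty_iff]
    exact ⟨0, hSD (IsAdmissible.zero (R := R))⟩
  obtain ⟨z, rfl⟩ := hDc.exists_eq_range hne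
  have hz : ∀ n, IsAdmissible R (z n) := fun n ↦ hDS ⟨n, rfl⟩
  refine ⟨fun n ↦ z n, hz, fun ν hν ↦ le_antisymm ?_ (ciSup_le fun n ↦
    (hz n).integral_le_dualSup hν)⟩
  refine csSup_le ⟨0, 0, .zero, by simp⟩ ?_
  rintro _ ⟨ζ, hζ, rfl⟩
  obtain ⟨w, hw, hlim⟩ := mem_closure_iff_seq_limit.1
    (hSD (show (⟨ζ, hζ.smooth.continuous⟩ : C(Plane, ℝ)) ∈ S from hζ))
  have hbdd : BddAbove (Set.range fun n ↦ ∫ x, z n x ∂ν) :=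
    (bddAbove_admissible (R := R) hν).mono (by rintro _ ⟨n, rfl⟩; exact ⟨_, hz n, rfl⟩)
  have hfin : IsFiniteMeasure (ν.restrict (openSquare R)) := ⟨by simpa using hν⟩
  have hwS : ∀ n, IsAdmissible R (w n) := fun n ↦ hDS (hw n)
  have hconv : Filter.Tendsto (fun n ↦ ∫ x, w n x ∂ν) Filter.atTop (nhds (∫ x, ζ x ∂ν)) := by
    simp_rw [← fun n ↦ (hwS n).setIntegral_eq ν, ← hζ.setIntegral_eq ν]
    refine tendsto_integral_of_dominated_convergence (fun _ ↦ 2 * |R|)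
      (fun n ↦ (w n).continuous.aestronglyMeasurable) (integrable_const _)
      (fun n ↦ .of_forall (hwS n).norm_le) (.of_forall fun x ↦ ?_)
    exact ((continuous_eval_const x).tendsto _).comp hlim
  refine le_of_tendsto hconv (.of_forall fun n ↦ ?_)
  obtain ⟨m, hm⟩ := hw n
  rw [← hm]
  exact le_ciSup hbdd m

lemma IsUnitPoissonProcess.integrable_dualSup {Ω : Type*} [MeasurableSpace Ω] {P : Measure Ω}
    {μ : Ω → Measure Plane} (h : IsUnitPoissonProcess P μ) (R : ℝ) :
    Integrable (fun ω ↦ dualSup R (μ ω)) P := by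
  have hQ : MeasurableSet (openSquare R) := measurableSet_openBox _ _
  have hv : volume (openSquare R) ≠ ∞ := volume_openBox_ne_top _ _
  obtain ⟨z, hz, hsup⟩ := exists_seq_dualSup_eq_iSup R
  refine ((h.integrable_toReal hQ hv).const_mul (2 * |R|)).mono' ?_ ?_
  · refine AEMeasurable.aestronglyMeasurable ?_
    have h1 : AEMeasurable (fun ω ↦ ⨆ n, ∫ x in openSquare R, z n x ∂(μ ω)) P :=
      AEMeasurable.iSup fun n ↦ h.aemeasurable_setIntegral hQ hv
        (hz n).smooth.continuous.stronglyMeasurable (hz n).norm_le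
    refine h1.congr ?_
    filter_upwards [h.ae_lt_top hQ hv] with ω hω
    simp only [hsup _ hω, fun n ↦ (hz n).setIntegral_eq (μ ω)]
  · filter_upwards [h.ae_lt_top hQ hv] with ω hω
    exact abs_dualSup_le hω

/-! ### Gradients of compactly supported functions, and a fixed profile -/

lemma norm_gradient (f : Plane → ℝ) (x : Plane) : ‖gradient f x‖ = ‖fderiv ℝ f x‖ := by
  rw [gradient, LinearIsometryEquiv.norm_map]

lemma gradient_eq_zero_of_notMem_tsupport {f : Plane → ℝ} {x : Plane} (hx : x ∉ tsupport f) :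
    gradient f x = 0 := by
  rw [← norm_eq_zero, norm_gradient, norm_eq_zero]
  exact fderiv_of_notMem_tsupport ℝ hx

lemma continuous_gradient {f : Plane → ℝ} (hf : ContDiff ℝ (⊤ : ℕ∞) f) :
    Continuous (gradient f) :=
  (InnerProductSpace.toDual ℝ Plane).symm.continuous.comp (hf.continuous_fderiv (by simp))

lemma hasCompactSupport_of_tsupport_subset_openBox {f : Plane → ℝ} {a b : Fin 2 → ℝ}
    (hf : tsupport f ⊆ openBox a b) : HasCompactSupport f := by
  refine Metric.isCompact_of_isClosed_isBounded (isClosed_tsupport f) ?_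
  refine (Metric.isBounded_iff_subset_closedBall 0).2
    ⟨2 * (∑ c, (|a c| + |b c|)), fun x hx ↦ ?_⟩
  rw [mem_closedBall_zero_iff]
  refine norm_le_two_mul fun c ↦ ?_
  have h1 := hf hx c
  refine le_trans ?_ (Finset.single_le_sum (f := fun c ↦ |a c| + |b c|)
    (fun i _ ↦ by positivity) (Finset.mem_univ c))
  rw [abs_le]
  constructor
  · linarith [neg_abs_le (a c), abs_nonneg (b c), h1.1]
  · linarith [le_abs_self (b c), abs_nonneg (a c), h1.2]

lemma hasCompactSupport_gradient {f : Plane → ℝ} (hf : HasCompactSupport f) :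
    HasCompactSupport (gradient f) :=
  hf.mono' fun _ hx ↦ by
    by_contra h
    exact hx (gradient_eq_zero_of_notMem_tsupport h)

lemma integral_inner_gradient_eq_zero {f : Plane → ℝ} (hf : ContDiff ℝ (⊤ : ℕ∞) f)
    (hc : HasCompactSupport f) (v : Plane) : ∫ x, inner ℝ v (gradient f x) = 0 := by
  have h1 : Integrable (fun x ↦ fderiv ℝ f x v) :=
    ((hf.continuous_fderiv (by simp)).clm_apply continuous_const).integrable_of_hasCompactSupport
      (hc.fderiv_apply ℝ v)
  have h2 := integral_mul_fderiv_eq_neg_fderiv_mul_of_integrable (μ := (volume : Measure Plane))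
    (f := fun _ ↦ (1 : ℝ)) (g := f) (v := v) (by simp) (by simpa using h1)
    (by simpa using hf.continuous.integrable_of_hasCompactSupport hc)
    (fun x _ ↦ by fun_prop) (fun x _ ↦ hf.differentiable (by simp) x)
  simp only [one_mul, fderiv_fun_const, Pi.zero_apply, zero_apply, zero_mul,
    integral_zero, neg_zero] at h2
  rw [← h2]
  congr 1
  ext x
  simp [inner_gradient_right]

/-- A smooth profile in the unit square. -/
structure IsProfile (φ : Plane → ℝ) (B : ℝ) : Prop where
  admissible : IsAdmissible 1 φ
  lipschitz : ∀ x y, ‖gradient φ x - gradient φ y‖ ≤ B * ‖x - y‖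
  pos : 0 < ∫ x, φ x ^ 2

lemma exists_bump_of_mem_openSquare {p : Plane} {r : ℝ} (hr : 0 < r)
    (hp : ∀ c, r < p c ∧ p c < 1 - r) : ∃ b : Plane → ℝ, ContDiff ℝ (⊤ : ℕ∞) b ∧
      tsupport b ⊆ openSquare 1 ∩ Metric.closedBall p r ∧ b p = 1 ∧ 0 < ∫ x, b x := by
  let b : ContDiffBump p := ⟨r / 2, r, by positivity, by linarith⟩
  refine ⟨b, b.contDiff, ?_, b.one_of_mem_closedBall (Metric.mem_closedBall_self (by positivity)),
    b.integral_pos⟩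
  rw [b.tsupport_eq]
  refine Set.subset_inter (fun x hx c ↦ ?_) subset_rfl
  have h1 : |x c - p c| ≤ r := by
    have := PiLp.norm_apply_le (x - p) c
    rw [Metric.mem_closedBall, dist_eq_norm] at hx
    exact this.trans hx
  have := abs_le.1 h1
  constructor <;> linarith [hp c]

lemma exists_isProfile : ∃ φ B, 0 < B ∧ IsProfile φ B := by
  obtain ⟨b₁, hs₁, ht₁, hb₁, hi₁⟩ := exists_bump_of_mem_openSquare (p := !₂[1 / 4, 1 / 2])
    (r := 1 / 8) (by norm_num) (by intro c; fin_cases c <;> norm_num)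
  obtain ⟨b₂, hs₂, ht₂, hb₂, hi₂⟩ := exists_bump_of_mem_openSquare (p := !₂[3 / 4, 1 / 2])
    (r := 1 / 8) (by norm_num) (by intro c; fin_cases c <;> norm_num)
  set I₁ := ∫ x, b₁ x
  set I₂ := ∫ x, b₂ x
  -- The two bumps have disjoint supports; weighting each by the integral of the other makes the
  -- mean zero.
  let φ₀ : Plane → ℝ := fun x ↦ I₂ * b₁ x - I₁ * b₂ x
  have hsm : ContDiff ℝ (⊤ : ℕ∞) φ₀ := (contDiff_const.mul hs₁).sub (contDiff_const.mul hs₂)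
  have hsupp : tsupport φ₀ ⊆ openSquare 1 := by
    refine (closure_minimal (t := tsupport b₁ ∪ tsupport b₂) ?_
      ((isClosed_tsupport _).union (isClosed_tsupport _))).trans
      (Set.union_subset (fun x hx ↦ (ht₁ hx).1) (fun x hx ↦ (ht₂ hx).1))
    intro x hx
    by_contra hn
    rw [Set.mem_union, not_or] at hn
    apply hx
    simp [φ₀, image_eq_zero_of_notMem_tsupport hn.1, image_eq_zero_of_notMem_tsupport hn.2]
  have hcs : HasCompactSupport φ₀ := hasCompactSupport_of_tsupport_subset_openBox hsupp
  have hc₁ : HasCompactSupport b₁ :=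
    hasCompactSupport_of_tsupport_subset_openBox fun x hx ↦ (ht₁ hx).1
  have hc₂ : HasCompactSupport b₂ :=
    hasCompactSupport_of_tsupport_subset_openBox fun x hx ↦ (ht₂ hx).1
  have hint : ∫ x, φ₀ x = 0 := by
    rw [integral_sub ((hs₁.continuous.integrable_of_hasCompactSupport hc₁).const_mul _)
      ((hs₂.continuous.integrable_of_hasCompactSupport hc₂).const_mul _), integral_const_mul,
      integral_const_mul]
    ring
  -- Dividing by `C + 1` rather than `C` normalises the gradient without needing `C ≠ 0`.
  obtain ⟨C, hC⟩ := (hasCompactSupport_gradient hcs).exists_bound_of_continuous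
    (continuous_gradient hsm)
  have hC0 : 0 ≤ C := (norm_nonneg _).trans (hC 0)
  let t : ℝ := 1 / (C + 1)
  have ht : 0 < t := by positivity
  let φ : Plane → ℝ := fun x ↦ t * φ₀ x
  have hφs : ContDiff ℝ (⊤ : ℕ∞) φ := contDiff_const.mul hsm
  have hφt : tsupport φ ⊆ openSquare 1 := (tsupport_mul_subset_right).trans hsupp
  have hφc : HasCompactSupport φ := hasCompactSupport_of_tsupport_subset_openBox hφt
  have hgr : ∀ x, gradient φ x = t • gradient φ₀ x := fun x ↦ by
    simp only [gradient, φ]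
    rw [fderiv_const_mul (hsm.differentiable (by simp) x), map_smul]
  have hgC1 : ContDiff ℝ 1 (gradient φ) :=
    (InnerProductSpace.toDual ℝ Plane).symm.contDiff.comp
      (hφs.fderiv_right (m := 1) (WithTop.coe_le_coe.2 le_top))
  obtain ⟨K, hK⟩ := ContDiff.lipschitzWith_of_hasCompactSupport
    (hasCompactSupport_gradient hφc) hgC1 one_ne_zero
  refine ⟨φ, K + 1, by positivity, ⟨hφs, hφt, fun x ↦ ?_, ?_⟩, fun x y ↦ ?_, ?_⟩
  · rw [hgr, norm_smul, Real.norm_of_nonneg ht.le]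
    have h1 := hC x
    simp only [t]
    rw [one_div, inv_mul_le_one₀ (by positivity)]
    linarith
  · simp only [φ]
    rw [integral_const_mul, hint, mul_zero]
  · have := hK.dist_le_mul x y
    rw [dist_eq_norm, dist_eq_norm] at this
    refine this.trans ?_
    gcongr
    linarith
  · refine Continuous.integral_pos_of_hasCompactSupport_nonneg_nonzero
      (x := !₂[1 / 4, 1 / 2]) (hφs.continuous.pow 2) ?_ (fun x ↦ sq_nonneg _) ?_
    · exact hφc.comp_left (g := fun y : ℝ ↦ y ^ 2) (by simp)
    · have h2 : b₂ !₂[1 / 4, 1 / 2] = 0 := by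
        refine image_eq_zero_of_notMem_tsupport fun hm ↦ ?_
        have h3 := (ht₂ hm).2
        rw [Metric.mem_closedBall, dist_eq_norm] at h3
        have h4 := (PiLp.norm_apply_le ((!₂[1 / 4, 1 / 2] : Plane) - !₂[3 / 4, 1 / 2]) 0).trans h3
        simp at h4
        norm_num at h4
      have : φ !₂[1 / 4, 1 / 2] = t * I₂ := by simp only [φ, φ₀, h2, hb₁]; ring
      rw [this]
      positivity

/-! ### Grid cells and rescaled bumps -/

/-- The cell of side length `ℓ` with lower left corner `ℓ i`. -/
def gridCell (ℓ : ℝ) {n : ℕ} (i : Fin 2 → Fin n) : Set Plane :=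
  openBox (fun c ↦ (i c : ℝ) * ℓ) (fun c ↦ ((i c : ℝ) + 1) * ℓ)

/-- The profile `φ` rescaled to the cell `gridCell ℓ i`, with the gradient size preserved. -/
noncomputable def gridBump (φ : Plane → ℝ) (ℓ : ℝ) {n : ℕ} (i : Fin 2 → Fin n) (x : Plane) : ℝ :=
  ℓ * φ (ℓ⁻¹ • x - WithLp.toLp 2 fun c ↦ (i c : ℝ))

section Grid

variable {φ : Plane → ℝ} {B ℓ : ℝ} {n : ℕ}

lemma integral_comp_rescale (hℓ : 0 < ℓ) (g : Plane → ℝ) (v : Plane) :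
    ∫ x, g (ℓ⁻¹ • x - v) = ℓ ^ 2 * ∫ x, g x := by
  have := Measure.integral_comp_inv_smul (volume : Measure Plane) (fun x ↦ g (x - v)) ℓ
  rw [this, integral_sub_right_eq_self]
  simp [abs_of_pos hℓ]

lemma measurableSet_gridCell (i : Fin 2 → Fin n) : MeasurableSet (gridCell ℓ i) :=
  measurableSet_openBox _ _

lemma volume_gridCell (hℓ : 0 < ℓ) (i : Fin 2 → Fin n) :
    volume (gridCell ℓ i) = ENNReal.ofReal (ℓ ^ 2) := by
  rw [gridCell, volume_openBox, ← ENNReal.ofReal_mul (by ring_nf; exact hℓ.le)]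
  congr 1
  ring

lemma gridCell_subset (hℓ : 0 < ℓ) (i : Fin 2 → Fin n) :
    gridCell ℓ i ⊆ openSquare (n * ℓ) := fun x hx c ↦ by
  have h1 := hx c
  have h2 : ((i c : ℕ) : ℝ) + 1 ≤ n := by exact_mod_cast (i c).2
  constructor
  · exact lt_of_le_of_lt (by positivity) h1.1
  · exact h1.2.trans_le (mul_le_mul_of_nonneg_right h2 hℓ.le)

lemma norm_sub_le_of_mem_gridCell {i : Fin 2 → Fin n} {x y : Plane} (hx : x ∈ gridCell ℓ i)
    (hy : y ∈ gridCell ℓ i) : ‖x - y‖ ≤ 2 * ℓ := by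
  refine norm_le_two_mul fun c ↦ ?_
  have h1 := hx c
  have h2 := hy c
  simp only [PiLp.sub_apply]
  rw [abs_le]
  constructor <;> nlinarith

lemma pairwiseDisjoint_gridCell (hℓ : 0 < ℓ) :
    Pairwise (Function.onFun Disjoint fun i : Fin 2 → Fin n ↦ gridCell ℓ i) := by
  intro i j hij
  refine Set.disjoint_left.2 fun x hi hj ↦ hij ?_
  ext c
  have h1 := hi c
  have h2 := hj c
  have h3 : ((i c : ℕ) : ℝ) < (j c : ℕ) + 1 := lt_of_mul_lt_mul_right (h1.1.trans h2.2) hℓ.le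
  have h4 : ((j c : ℕ) : ℝ) < (i c : ℕ) + 1 := lt_of_mul_lt_mul_right (h2.1.trans h1.2) hℓ.le
  norm_cast at h3 h4
  omega

namespace IsProfile

lemma contDiff_gridBump (h : IsProfile φ B) (i : Fin 2 → Fin n) :
    ContDiff ℝ (⊤ : ℕ∞) (gridBump φ ℓ i) :=
  contDiff_const.mul (h.admissible.smooth.comp
    ((contDiff_const_smul _).sub contDiff_const))

lemma norm_gridBump_le (h : IsProfile φ B) (i : Fin 2 → Fin n)
    (x : Plane) : ‖gridBump φ ℓ i x‖ ≤ 2 * |ℓ| := by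
  rw [gridBump, norm_mul, Real.norm_eq_abs ℓ, mul_comm]
  have := h.admissible.norm_le (ℓ⁻¹ • x - WithLp.toLp 2 fun c ↦ (i c : ℝ))
  rw [abs_one, mul_one] at this
  gcongr

lemma tsupport_gridBump_subset (h : IsProfile φ B) (hℓ : 0 < ℓ) (i : Fin 2 → Fin n) :
    tsupport (gridBump φ ℓ i) ⊆ gridCell ℓ i := by
  have h1 : tsupport (gridBump φ ℓ i) ⊆
      (fun x : Plane ↦ ℓ⁻¹ • x - WithLp.toLp 2 fun c ↦ (i c : ℝ)) ⁻¹' tsupport φ :=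
    tsupport_mul_subset_right.trans (tsupport_comp_subset_preimage φ (by fun_prop))
  intro x hx c
  have h2 := h.admissible.support_subset (h1 hx) c
  simp only [PiLp.sub_apply, PiLp.smul_apply, smul_eq_mul] at h2
  have h3 : ℓ⁻¹ * x c = x c / ℓ := by rw [div_eq_inv_mul]
  rw [h3] at h2
  constructor
  · exact (lt_div_iff₀ hℓ).1 (by linarith [h2.1])
  · exact (div_lt_iff₀ hℓ).1 (by linarith [h2.2])

lemma hasCompactSupport_gridBump (h : IsProfile φ B) (hℓ : 0 < ℓ) (i : Fin 2 → Fin n) :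
    HasCompactSupport (gridBump φ ℓ i) :=
  hasCompactSupport_of_tsupport_subset_openBox (h.tsupport_gridBump_subset hℓ i)

lemma gridBump_eq_zero (h : IsProfile φ B) (hℓ : 0 < ℓ) (i : Fin 2 → Fin n)
    {x : Plane} (hx : x ∉ gridCell ℓ i) : gridBump φ ℓ i x = 0 :=
  image_eq_zero_of_notMem_tsupport fun hx' ↦ hx (h.tsupport_gridBump_subset hℓ i hx')

lemma gradient_gridBump_eq_zero (h : IsProfile φ B) (hℓ : 0 < ℓ) (i : Fin 2 → Fin n)
    {x : Plane} (hx : x ∉ gridCell ℓ i) :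
    gradient (gridBump φ ℓ i) x = 0 :=
  gradient_eq_zero_of_notMem_tsupport fun hx' ↦ hx (h.tsupport_gridBump_subset hℓ i hx')

lemma gradient_gridBump (h : IsProfile φ B) (hℓ : 0 < ℓ) (i : Fin 2 → Fin n)
    (x : Plane) : gradient (gridBump φ ℓ i) x =
    gradient φ (ℓ⁻¹ • x - WithLp.toLp 2 fun c ↦ (i c : ℝ)) := by
  have hd := (h.admissible.smooth.differentiable (by simp)
    (ℓ⁻¹ • x - WithLp.toLp 2 fun c ↦ (i c : ℝ))).hasFDerivAt
  have h1 : HasFDerivAt (fun x : Plane ↦ ℓ⁻¹ • x - WithLp.toLp 2 fun c ↦ (i c : ℝ))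
      (ℓ⁻¹ • ContinuousLinearMap.id ℝ Plane) x :=
    ((hasFDerivAt_id x).const_smul ℓ⁻¹).sub_const _
  have h2 := (hd.comp x h1).const_mul ℓ
  rw [gradient, gradient]
  congr 1
  refine HasFDerivAt.fderiv ?_
  convert! h2 using 1
  ext y
  simp [hℓ.ne']

lemma norm_gradient_gridBump_le (h : IsProfile φ B) (hℓ : 0 < ℓ) (i : Fin 2 → Fin n)
    (x : Plane) : ‖gradient (gridBump φ ℓ i) x‖ ≤ 1 := by
  rw [h.gradient_gridBump hℓ]
  exact h.admissible.gradient_le _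

lemma norm_gradient_gridBump_sub_le (h : IsProfile φ B) (hℓ : 0 < ℓ) (i : Fin 2 → Fin n)
    (x y : Plane) :
    ‖gradient (gridBump φ ℓ i) x - gradient (gridBump φ ℓ i) y‖ ≤ B / ℓ * ‖x - y‖ := by
  rw [h.gradient_gridBump hℓ, h.gradient_gridBump hℓ]
  refine (h.lipschitz _ _).trans (le_of_eq ?_)
  rw [sub_sub_sub_cancel_right, ← smul_sub, norm_smul, norm_inv, Real.norm_of_nonneg hℓ.le]
  ring

lemma integral_gridBump (h : IsProfile φ B) (hℓ : 0 < ℓ) (i : Fin 2 → Fin n) :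
    ∫ x, gridBump φ ℓ i x = 0 := by
  simp only [gridBump]
  rw [integral_const_mul, integral_comp_rescale hℓ, h.admissible.integral_eq_zero]
  simp

lemma setIntegral_gridBump (h : IsProfile φ B) (hℓ : 0 < ℓ) (i : Fin 2 → Fin n)
    (ν : Measure Plane) :
    ∫ x in gridCell ℓ i, gridBump φ ℓ i x ∂ν = ∫ x, gridBump φ ℓ i x ∂ν :=
  setIntegral_eq_integral_of_forall_compl_eq_zero fun _ hx ↦ h.gridBump_eq_zero hℓ i hx

lemma setIntegral_gridBump_sq (h : IsProfile φ B) (hℓ : 0 < ℓ) (i : Fin 2 → Fin n) :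
    ∫ x in gridCell ℓ i, gridBump φ ℓ i x ^ 2 = ℓ ^ 4 * ∫ x, φ x ^ 2 := by
  rw [setIntegral_eq_integral_of_forall_compl_eq_zero fun x hx ↦ by
    rw [h.gridBump_eq_zero hℓ i hx]; simp]
  simp only [gridBump, mul_pow]
  rw [integral_const_mul, integral_comp_rescale hℓ (fun x ↦ φ x ^ 2)]
  ring

end IsProfile

end Grid

/-! ### Moments of the bump statistics -/

namespace IsProfile

variable {Ω : Type*} [MeasurableSpace Ω] {P : Measure Ω}
  {μ : Ω → Measure Plane} {φ : Plane → ℝ} {B ℓ : ℝ} {n : ℕ}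

lemma integrable_abs_integral_gridBump (h : IsProfile φ B) (hμ : IsUnitPoissonProcess P μ)
    (hℓ : 0 < ℓ) (i : Fin 2 → Fin n) :
    Integrable (fun ω ↦ |∫ x, gridBump φ ℓ i x ∂(μ ω)|) P := by
  have := hμ.integrable_setIntegral (measurableSet_gridCell (ℓ := ℓ) i)
    (volume_openBox_ne_top _ _) (h.contDiff_gridBump (ℓ := ℓ) i).continuous.stronglyMeasurable
    (h.norm_gridBump_le i)
  simp only [h.setIntegral_gridBump hℓ i] at this
  exact this.abs

lemma integral_sq_integral_gridBump_le [IsProbabilityMeasure P] (h : IsProfile φ B)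
    (hμ : IsUnitPoissonProcess P μ) (hℓ : 0 < ℓ) (i : Fin 2 → Fin n) :
    Integrable (fun ω ↦ (∫ x, gridBump φ ℓ i x ∂(μ ω)) ^ 2) P ∧
    ∫ ω, (∫ x, gridBump φ ℓ i x ∂(μ ω)) ^ 2 ∂P ≤ Real.pi ^ 2 * (ℓ ^ 4 * ∫ x, φ x ^ 2) := by
  have := hμ.integral_sq_le (measurableSet_gridCell (ℓ := ℓ) i)
    (volume_openBox_ne_top _ _) (h.contDiff_gridBump (ℓ := ℓ) i).continuous.stronglyMeasurable
    (h.norm_gridBump_le i) (by rw [h.setIntegral_gridBump hℓ i, h.integral_gridBump hℓ i])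
  simpa only [h.setIntegral_gridBump hℓ i, h.setIntegral_gridBump_sq hℓ i] using this

/-- The frequency `s = ℓ⁻²` matches the standard deviation `~ ℓ²`, so the exponent becomes
independent of `ℓ`. The condition `1 ≤ ℓ` keeps the phase within `[-π, π]`, where `1 - cos y ≥ (2 /
π²) * y²`; it is what limits the number of usable scales to order `ln R`. -/
lemma le_integral_abs_integral_gridBump [IsProbabilityMeasure P] (h : IsProfile φ B)
    (hμ : IsUnitPoissonProcess P μ) (hℓ : 1 ≤ ℓ) (i : Fin 2 → Fin n) :
    (1 - Real.exp (-(2 / Real.pi ^ 2 * ∫ x, φ x ^ 2))) * ℓ ^ 2 ≤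
      ∫ ω, |∫ x, gridBump φ ℓ i x ∂(μ ω)| ∂P := by
  have hℓ0 : 0 < ℓ := by linarith
  have hv : volume (gridCell ℓ i) ≠ ∞ := volume_openBox_ne_top _ _
  have hfin : IsFiniteMeasure (volume.restrict (gridCell ℓ i)) := ⟨by simpa using hv.lt_top⟩
  have hc := (h.contDiff_gridBump (ℓ := ℓ) i).continuous
  have h1 := hμ.one_sub_exp_le_mul_integral_abs (measurableSet_gridCell (ℓ := ℓ) i)
    hv hc.stronglyMeasurable (h.norm_gridBump_le i) (s := (ℓ ^ 2)⁻¹) (by positivity)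
  simp only [h.setIntegral_gridBump hℓ0 i] at h1
  have h2 : 2 / Real.pi ^ 2 * ∫ x, φ x ^ 2 ≤
      ∫ x in gridCell ℓ i, (1 - Real.cos ((ℓ ^ 2)⁻¹ * gridBump φ ℓ i x)) := by
    calc _ = ∫ x in gridCell ℓ i, 2 / Real.pi ^ 2 * (((ℓ ^ 2)⁻¹) ^ 2 * gridBump φ ℓ i x ^ 2) := by
          rw [integral_const_mul, integral_const_mul, h.setIntegral_gridBump_sq hℓ0 i]
          field_simp
      _ ≤ _ := by
          refine integral_mono ?_ ?_ fun x ↦ ?_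
          · refine (Integrable.const_mul ?_ _).const_mul _
            refine .of_bound (hc.pow 2).aestronglyMeasurable ((2 * |ℓ|) ^ 2) (.of_forall fun x ↦ ?_)
            rw [norm_pow]
            exact pow_le_pow_left₀ (norm_nonneg _) (h.norm_gridBump_le i x) 2
          · refine .of_bound (C := 2) (by fun_prop) (.of_forall fun x ↦ ?_)
            set y := (ℓ ^ 2)⁻¹ * gridBump φ ℓ i x
            rw [Real.norm_eq_abs, abs_le]
            constructor <;> linarith [Real.cos_le_one y, Real.neg_one_le_cos y]
          · have h3 := h.norm_gridBump_le (ℓ := ℓ) i x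
            rw [abs_of_pos hℓ0, Real.norm_eq_abs] at h3
            have h4 : |(ℓ ^ 2)⁻¹ * gridBump φ ℓ i x| ≤ Real.pi := by
              rw [abs_mul, abs_of_pos (by positivity)]
              calc (ℓ ^ 2)⁻¹ * |gridBump φ ℓ i x| ≤ (ℓ ^ 2)⁻¹ * (2 * ℓ) := by gcongr
                _ = 2 / ℓ := by field_simp
                _ ≤ 2 := div_le_self (by norm_num) hℓ
                _ ≤ Real.pi := Real.two_le_pi
            have h5 := Real.cos_le_one_sub_mul_cos_sq h4
            rw [mul_pow] at h5
            simp only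
            linarith
  have h3 : 1 - Real.exp (-(2 / Real.pi ^ 2 * ∫ x, φ x ^ 2)) ≤
      (ℓ ^ 2)⁻¹ * ∫ ω, |∫ x, gridBump φ ℓ i x ∂(μ ω)| ∂P := by
    refine le_trans ?_ h1
    gcongr
  calc _ ≤ (ℓ ^ 2)⁻¹ * (∫ ω, |∫ x, gridBump φ ℓ i x ∂(μ ω)| ∂P) * ℓ ^ 2 := by gcongr
    _ = _ := by field_simp

end IsProfile

/-! ### Superposition of bumps on a single grid -/

lemma volume_real_openSquare {R : ℝ} (hR : 0 ≤ R) : volume.real (openSquare R) = R ^ 2 := by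
  rw [openSquare_eq_openBox, Measure.real, volume_openBox, sub_zero, ENNReal.toReal_mul,
    ENNReal.toReal_ofReal hR, sq]

/-- A linear combination of the rescaled profiles on the cells of an `n × n` grid. -/
noncomputable def gridSum (φ : Plane → ℝ) (ℓ : ℝ) {n : ℕ} (s : (Fin 2 → Fin n) → ℝ)
    (x : Plane) : ℝ :=
  ∑ i, s i * gridBump φ ℓ i x

lemma integral_gridSum_eq_sum {φ : Plane → ℝ} {ℓ : ℝ} {n : ℕ} (s : (Fin 2 → Fin n) → ℝ)
    {ν : Measure Plane} (hν : ∀ i : Fin 2 → Fin n, Integrable (gridBump φ ℓ i) ν) :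
    ∫ x, gridSum φ ℓ s x ∂ν = ∑ i, s i * ∫ x, gridBump φ ℓ i x ∂ν := by
  simp only [gridSum]
  rw [integral_finsetSum _ fun i _ ↦ (hν i).const_mul (s i)]
  simp only [integral_const_mul]

namespace IsProfile

variable {φ : Plane → ℝ} {B ℓ : ℝ} {n : ℕ}

lemma contDiff_gridSum (h : IsProfile φ B) (s : (Fin 2 → Fin n) → ℝ) :
    ContDiff ℝ (⊤ : ℕ∞) (gridSum φ ℓ s) :=
  ContDiff.sum fun i _ ↦ contDiff_const.mul (h.contDiff_gridBump i)

lemma gradient_gridSum (h : IsProfile φ B) (s : (Fin 2 → Fin n) → ℝ) (x : Plane) :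
    gradient (gridSum φ ℓ s) x = ∑ i, s i • gradient (gridBump φ ℓ i) x := by
  have hd : ∀ i : Fin 2 → Fin n, DifferentiableAt ℝ (gridBump φ ℓ i) x := fun i ↦
    (h.contDiff_gridBump i).differentiable (by simp) x
  have hsum : gridSum φ ℓ s = fun x ↦ ∑ i, s i * gridBump φ ℓ i x := rfl
  rw [gradient, hsum, fderiv_fun_sum fun i _ ↦ (hd i).const_mul (s i), map_sum]
  refine Finset.sum_congr rfl fun i _ ↦ ?_
  rw [fderiv_const_mul (hd i), map_smul, gradient]

lemma gradient_gridSum_of_mem (h : IsProfile φ B) (hℓ : 0 < ℓ) (s : (Fin 2 → Fin n) → ℝ)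
    {x : Plane} {i : Fin 2 → Fin n} (hx : x ∈ gridCell ℓ i) :
    gradient (gridSum φ ℓ s) x = s i • gradient (gridBump φ ℓ i) x := by
  rw [h.gradient_gridSum]
  refine Finset.sum_eq_single_of_mem i (Finset.mem_univ i) fun j _ hj ↦ ?_
  rw [h.gradient_gridBump_eq_zero hℓ j, smul_zero]
  exact Set.disjoint_left.1 (pairwiseDisjoint_gridCell hℓ hj.symm) hx

lemma gradient_gridSum_of_notMem (h : IsProfile φ B) (hℓ : 0 < ℓ) (s : (Fin 2 → Fin n) → ℝ)
    {x : Plane} (hx : ∀ i : Fin 2 → Fin n, x ∉ gridCell ℓ i) :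
    gradient (gridSum φ ℓ s) x = 0 := by
  rw [h.gradient_gridSum]
  exact Finset.sum_eq_zero fun i _ ↦ by rw [h.gradient_gridBump_eq_zero hℓ i (hx i), smul_zero]

lemma norm_gradient_gridSum_le (h : IsProfile φ B) (hℓ : 0 < ℓ) {s : (Fin 2 → Fin n) → ℝ}
    (hs : ∀ i, |s i| ≤ 1) (x : Plane) : ‖gradient (gridSum φ ℓ s) x‖ ≤ 1 := by
  by_cases hx : ∃ i : Fin 2 → Fin n, x ∈ gridCell ℓ i
  · obtain ⟨i, hi⟩ := hx
    rw [h.gradient_gridSum_of_mem hℓ s hi, norm_smul, Real.norm_eq_abs]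
    exact mul_le_one₀ (hs i) (norm_nonneg _) (h.norm_gradient_gridBump_le hℓ i x)
  · rw [h.gradient_gridSum_of_notMem hℓ s (not_exists.1 hx), norm_zero]
    exact zero_le_one

/-- Each of `x` and `y` lies in at most one cell, so at most two terms of the sum differ; hence the
factor 2. -/
lemma norm_gradient_gridSum_sub_le (h : IsProfile φ B) (hB : 0 ≤ B) (hℓ : 0 < ℓ)
    {s : (Fin 2 → Fin n) → ℝ} (hs : ∀ i, |s i| ≤ 1) (x y : Plane) :
    ‖gradient (gridSum φ ℓ s) x - gradient (gridSum φ ℓ s) y‖ ≤ 2 * B / ℓ * ‖x - y‖ := by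
  classical
  let T : Plane → Finset (Fin 2 → Fin n) := fun z ↦ Finset.univ.filter fun i ↦ z ∈ gridCell ℓ i
  have hT : ∀ z, (T z).card ≤ 1 := fun z ↦ Finset.card_le_one.2 fun i hi j hj ↦ by
    by_contra hij
    exact Set.disjoint_left.1 (pairwiseDisjoint_gridCell hℓ hij) (Finset.mem_filter.1 hi).2
      (Finset.mem_filter.1 hj).2
  have hc : ((T x ∪ T y).card : ℝ) ≤ 2 := by
    exact_mod_cast (Finset.card_union_le _ _).trans (add_le_add (hT x) (hT y))
  rw [h.gradient_gridSum, h.gradient_gridSum, ← Finset.sum_sub_distrib,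
    ← Finset.sum_subset (Finset.subset_univ (T x ∪ T y))]
  · calc _ ≤ ∑ i ∈ T x ∪ T y, B / ℓ * ‖x - y‖ := by
          refine norm_sum_le_of_le _ fun i _ ↦ ?_
          rw [← smul_sub, norm_smul, Real.norm_eq_abs]
          exact (mul_le_of_le_one_left (norm_nonneg _) (hs i)).trans
            (h.norm_gradient_gridBump_sub_le hℓ i x y)
      _ = (T x ∪ T y).card * (B / ℓ * ‖x - y‖) := by rw [Finset.sum_const, nsmul_eq_mul]
      _ ≤ 2 * (B / ℓ * ‖x - y‖) := by gcongr
      _ = _ := by ring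
  · intro i _ hi
    simp only [T, Finset.mem_union, Finset.mem_filter, Finset.mem_univ, true_and, not_or] at hi
    rw [h.gradient_gridBump_eq_zero hℓ i hi.1, h.gradient_gridBump_eq_zero hℓ i hi.2, sub_self]

lemma tsupport_gridSum_subset (h : IsProfile φ B) (hℓ : 0 < ℓ) (s : (Fin 2 → Fin n) → ℝ) :
    tsupport (gridSum φ ℓ s) ⊆ openSquare (n * ℓ) := by
  refine (closure_minimal (t := ⋃ i : Fin 2 → Fin n, tsupport (gridBump φ ℓ i)) (fun x hx ↦ ?_)
    (isClosed_iUnion_of_finite fun i ↦ isClosed_tsupport _)).trans (Set.iUnion_subset fun i ↦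
      (h.tsupport_gridBump_subset hℓ i).trans (gridCell_subset hℓ i))
  by_contra hn
  rw [Set.mem_iUnion, not_exists] at hn
  exact hx (Finset.sum_eq_zero fun i _ ↦ by
    rw [image_eq_zero_of_notMem_tsupport (hn i), mul_zero])

lemma hasCompactSupport_gridSum (h : IsProfile φ B) (hℓ : 0 < ℓ) (s : (Fin 2 → Fin n) → ℝ) :
    HasCompactSupport (gridSum φ ℓ s) :=
  hasCompactSupport_of_tsupport_subset_openBox (h.tsupport_gridSum_subset hℓ s)

lemma integral_gridSum (h : IsProfile φ B) (hℓ : 0 < ℓ) (s : (Fin 2 → Fin n) → ℝ) :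
    ∫ x, gridSum φ ℓ s x = 0 := by
  rw [integral_gridSum_eq_sum s fun i ↦ (h.contDiff_gridBump
    i).continuous.integrable_of_hasCompactSupport (h.hasCompactSupport_gridBump hℓ i)]
  simp only [h.integral_gridBump hℓ, mul_zero, Finset.sum_const_zero]

lemma integral_norm_gradient_gridSum_sq_le (h : IsProfile φ B) (hℓ : 0 < ℓ)
    {s : (Fin 2 → Fin n) → ℝ} (hs : ∀ i, |s i| ≤ 1) :
    ∫ x, ‖gradient (gridSum φ ℓ s) x‖ ^ 2 ≤ (n * ℓ) ^ 2 := by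
  rw [← volume_real_openSquare (by positivity : 0 ≤ n * ℓ),
    ← setIntegral_eq_integral_of_forall_compl_eq_zero (s := openSquare (n * ℓ)) fun x hx ↦ by
      rw [gradient_eq_zero_of_notMem_tsupport fun hx' ↦ hx (h.tsupport_gridSum_subset hℓ s hx')]
      simp]
  have h1 := norm_setIntegral_le_of_norm_le_const (μ := volume)
    (f := fun x ↦ ‖gradient (gridSum φ ℓ s) x‖ ^ 2) (s := openSquare (n * ℓ)) (C := 1)
    (volume_openBox_ne_top _ _).lt_top (fun x _ ↦ by
      rw [norm_pow, norm_norm]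
      exact pow_le_one₀ (norm_nonneg _) (h.norm_gradient_gridSum_le hℓ hs x))
  rw [one_mul] at h1
  exact (le_abs_self _).trans h1

/-- Near-orthogonality of scales: the gradient of a bump has zero integral, so `g` may be replaced
by its oscillation `g - g p` on the cell, which is at most `2 * L * ℓ`. -/
lemma abs_integral_inner_gradient_gridBump_le (h : IsProfile φ B) (hℓ : 0 < ℓ)
    (i : Fin 2 → Fin n) {g : Plane → Plane} (hg : Continuous g) {L : ℝ} (hL0 : 0 ≤ L)
    (hL : ∀ x y, ‖g x - g y‖ ≤ L * ‖x - y‖) :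
    |∫ x, inner ℝ (g x) (gradient (gridBump φ ℓ i) x)| ≤ 2 * L * ℓ * ℓ ^ 2 := by
  have hcs := h.hasCompactSupport_gridBump hℓ i
  have hgc := continuous_gradient (h.contDiff_gridBump (ℓ := ℓ) i)
  let p : Plane := WithLp.toLp 2 fun c ↦ ((i c : ℝ) + 1 / 2) * ℓ
  have hp : p ∈ gridCell ℓ i := fun c ↦ by
    simp only [p]
    constructor <;> nlinarith
  have hint : ∀ f : Plane → Plane, Continuous f →
      Integrable fun x ↦ inner ℝ (f x) (gradient (gridBump φ ℓ i) x) := fun f hf ↦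
    (hf.inner hgc).integrable_of_hasCompactSupport
      ((hasCompactSupport_gradient hcs).mono fun x hx hx' ↦ hx (by simp only [hx', inner_zero_right]))
  have h1 : ∫ x, inner ℝ (g x) (gradient (gridBump φ ℓ i) x) =
      ∫ x in gridCell ℓ i, inner ℝ (g x - g p) (gradient (gridBump φ ℓ i) x) := by
    rw [setIntegral_eq_integral_of_forall_compl_eq_zero fun x hx ↦ by
      rw [h.gradient_gridBump_eq_zero hℓ i hx, inner_zero_right]]
    simp only [inner_sub_left]
    rw [integral_sub (hint g hg) (hint (fun _ ↦ g p) continuous_const),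
      integral_inner_gradient_eq_zero (h.contDiff_gridBump i) hcs, sub_zero]
  have hv : volume.real (gridCell ℓ i) = ℓ ^ 2 := by
    rw [Measure.real, volume_gridCell hℓ, ENNReal.toReal_ofReal (by positivity)]
  rw [h1, ← hv, ← Real.norm_eq_abs]
  refine norm_setIntegral_le_of_norm_le_const (volume_openBox_ne_top _ _).lt_top fun x hx ↦ ?_
  calc _ ≤ ‖g x - g p‖ * ‖gradient (gridBump φ ℓ i) x‖ := norm_inner_le_norm _ _
    _ ≤ ‖g x - g p‖ * 1 := by gcongr; exact h.norm_gradient_gridBump_le hℓ i x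
    _ ≤ L * ‖x - p‖ := by rw [mul_one]; exact hL x p
    _ ≤ L * (2 * ℓ) := by gcongr; exact norm_sub_le_of_mem_gridCell hx hp
    _ = _ := by ring

lemma abs_integral_inner_gradient_gridSum_le (h : IsProfile φ B) (hℓ : 0 < ℓ)
    {s : (Fin 2 → Fin n) → ℝ} (hs : ∀ i, |s i| ≤ 1)
    {g : Plane → Plane} (hg : Continuous g) {L : ℝ} (hL0 : 0 ≤ L)
    (hL : ∀ x y, ‖g x - g y‖ ≤ L * ‖x - y‖) :
    |∫ x, inner ℝ (g x) (gradient (gridSum φ ℓ s) x)| ≤ 2 * L * ℓ * (n * ℓ) ^ 2 := by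
  have hint : ∀ i : Fin 2 → Fin n,
      Integrable fun x ↦ inner ℝ (g x) (gradient (gridBump φ ℓ i) x) := fun i ↦
    (hg.inner (continuous_gradient (h.contDiff_gridBump i))).integrable_of_hasCompactSupport
      ((hasCompactSupport_gradient (h.hasCompactSupport_gridBump hℓ i)).mono
        fun x hx hx' ↦ hx (by simp only [hx', inner_zero_right]))
  simp only [h.gradient_gridSum, inner_sum, inner_smul_right]
  rw [integral_finsetSum _ fun i _ ↦ (hint i).const_mul (s i)]
  simp only [integral_const_mul]
  calc _ ≤ ∑ i : Fin 2 → Fin n, 2 * L * ℓ * ℓ ^ 2 := by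
        refine (Finset.abs_sum_le_sum_abs _ _).trans (Finset.sum_le_sum fun i _ ↦ ?_)
        rw [abs_mul]
        exact (mul_le_of_le_one_left (abs_nonneg _) (hs i)).trans
          (h.abs_integral_inner_gradient_gridBump_le hℓ i hg hL0 hL)
    _ = _ := by
        rw [Finset.sum_const, Finset.card_univ, Fintype.card_fun, Fintype.card_fin,
          Fintype.card_fin, nsmul_eq_mul]
        push_cast
        ring

end IsProfile

/-! ### Adding one scale to a controlled function -/

/-- An admissible function with Lipschitz gradient and controlled Dirichlet energy. -/
structure IsControlled (R L A : ℝ) (u : Plane → ℝ) : Prop extends IsAdmissible R u where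
  lipschitz : ∀ x y, ‖gradient u x - gradient u y‖ ≤ L * ‖x - y‖
  energy_le : ∫ x, ‖gradient u x‖ ^ 2 ≤ A

lemma isControlled_zero (R : ℝ) {L A : ℝ} (hL : 0 ≤ L) (hA : 0 ≤ A) : IsControlled R L A 0 := by
  have h0 : ∀ x, gradient (0 : Plane → ℝ) x = 0 := fun x ↦ gradient_const x 0
  refine ⟨.zero, fun x y ↦ ?_, ?_⟩
  · simp only [h0, sub_zero, norm_zero]; positivity
  · simpa [h0] using hA

lemma integrable_norm_gradient_sq {u : Plane → ℝ} (hu : ContDiff ℝ (⊤ : ℕ∞) u)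
    (hc : HasCompactSupport u) : Integrable fun x ↦ ‖gradient u x‖ ^ 2 :=
  ((continuous_gradient hu).norm.pow 2).integrable_of_hasCompactSupport
    ((hasCompactSupport_gradient hc).mono fun x hx hx' ↦ hx (by
      rw [Pi.pow_apply, hx', norm_zero, zero_pow two_ne_zero]))

lemma IsAdmissible.hasCompactSupport {R : ℝ} {u : Plane → ℝ} (h : IsAdmissible R u) :
    HasCompactSupport u :=
  hasCompactSupport_of_tsupport_subset_openBox h.support_subset

lemma integrable_of_tsupport_subset_openSquare {R : ℝ} {f : Plane → ℝ} (hf : Continuous f)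
    (ht : tsupport f ⊆ openSquare R) {ν : Measure Plane} (hν : ν (openSquare R) < ∞) :
    Integrable f ν := by
  obtain ⟨C, hC⟩ := (hasCompactSupport_of_tsupport_subset_openBox ht).exists_bound_of_continuous hf
  rw [← integrableOn_iff_integrable_of_support_subset ((subset_tsupport f).trans ht)]
  have : IsFiniteMeasure (ν.restrict (openSquare R)) := ⟨by simpa using hν⟩
  exact Integrable.of_bound hf.aestronglyMeasurable C (.of_forall hC)

/-- Few cells contain a point where the gradient is large. -/
lemma IsControlled.card_mul_sq_le {R L A : ℝ} {u : Plane → ℝ} (hu : IsControlled R L A u)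
    {ℓ : ℝ} (hℓ : 0 < ℓ) (hL0 : 0 ≤ L) (hLℓ : L * ℓ ≤ 1 / 8) {n : ℕ}
    {T : Finset (Fin 2 → Fin n)}
    (hT : ∀ i ∈ T, ∃ x ∈ gridCell ℓ i, 1 / 2 < ‖gradient u x‖) :
    T.card * ℓ ^ 2 ≤ 16 * A := by
  have hint := integrable_norm_gradient_sq hu.smooth hu.hasCompactSupport
  have hlow : ∀ x ∈ ⋃ i ∈ T, gridCell ℓ i, 1 / 16 ≤ ‖gradient u x‖ ^ 2 := by
    intro x hx
    simp only [Set.mem_iUnion] at hx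
    obtain ⟨i, hi, hx⟩ := hx
    obtain ⟨y, hy, hgy⟩ := hT i hi
    have h1 := hu.lipschitz y x
    have h2 : L * ‖y - x‖ ≤ L * (2 * ℓ) := by
      gcongr; exact norm_sub_le_of_mem_gridCell hy hx
    have h3 := norm_sub_norm_le (gradient u y) (gradient u x)
    -- Over a cell the gradient varies by at most `2 * L * ℓ ≤ 1 / 4`, so it stays above `1 / 4` on
    -- the whole cell and Chebyshev's inequality applies.
    have h4 : 1 / 4 ≤ ‖gradient u x‖ := by linarith
    nlinarith
  have hm : MeasurableSet (⋃ i ∈ T, gridCell ℓ i) :=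
    Finset.measurableSet_biUnion _ fun i _ ↦ measurableSet_gridCell i
  have hvol : volume (⋃ i ∈ T, gridCell ℓ i) = T.card * ENNReal.ofReal (ℓ ^ 2) := by
    rw [measure_biUnion_finset (fun i _ j _ hij ↦ pairwiseDisjoint_gridCell hℓ hij)
      fun i _ ↦ measurableSet_gridCell i]
    simp [volume_gridCell hℓ]
  have hvr : volume.real (⋃ i ∈ T, gridCell ℓ i) = T.card * ℓ ^ 2 := by
    rw [Measure.real, hvol, ENNReal.toReal_mul, ENNReal.toReal_ofReal (by positivity)]
    simp
  have h1 := setIntegral_ge_of_const_le_real hm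
    (by rw [hvol]; exact ENNReal.mul_ne_top (by simp) ENNReal.ofReal_ne_top) hlow
    hint.integrableOn
  have h2 := setIntegral_le_integral (s := ⋃ i ∈ T, gridCell ℓ i) hint
    (.of_forall fun x ↦ sq_nonneg _)
  rw [hvr] at h1
  linarith [hu.energy_le]

/-- Adding one more scale to a controlled function. -/
lemma IsControlled.exists_add_scale {φ : Plane → ℝ} {B : ℝ} (h : IsProfile φ B) (hB : 0 ≤ B)
    {n : ℕ} {R ℓ L A : ℝ} (hℓ : 0 < ℓ) (hR : n * ℓ = R) {u : Plane → ℝ}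
    (hu : IsControlled R L A u)
    (hL0 : 0 ≤ L) (hLℓ : L * ℓ ≤ 1 / 8) {a δ : ℝ} (ha0 : 0 ≤ a) (ha : a ≤ 1 / 2) (hδ : 0 < δ)
    {ν : Measure Plane} (hν : ν (openSquare R) < ∞) :
    ∃ u', IsControlled R (L + a * (2 * B / ℓ))
        (A + (4 * a * (L * ℓ) + a ^ 2) * R ^ 2) u' ∧
      ∫ x, u x ∂ν + a * (∑ i : Fin 2 → Fin n, (|∫ x, gridBump φ ℓ i x ∂ν| -
        δ / (2 * ℓ ^ 2) * (∫ x, gridBump φ ℓ i x ∂ν) ^ 2) - 8 * A / δ) ≤ ∫ x, u' x ∂ν := by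
  classical
  subst hR
  let Y : (Fin 2 → Fin n) → ℝ := fun i ↦ ∫ x, gridBump φ ℓ i x ∂ν
  let act : (Fin 2 → Fin n) → Prop := fun i ↦ ∀ x ∈ gridCell ℓ i, ‖gradient u x‖ ≤ 1 / 2
  -- The sign makes each contribution `|Y i|`. Cells where the gradient of `u` exceeds `1 / 2`
  -- somewhere are skipped; in the others `1 / 2 + a ≤ 1` preserves the gradient constraint.
  let s : (Fin 2 → Fin n) → ℝ := fun i ↦ if act i then (if 0 ≤ Y i then 1 else -1) else 0
  have hs : ∀ i, |s i| ≤ 1 := fun i ↦ by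
    simp only [s]; split_ifs <;> simp
  let w := gridSum φ ℓ s
  have hw : ContDiff ℝ (⊤ : ℕ∞) w := h.contDiff_gridSum s
  have hwc : HasCompactSupport w := h.hasCompactSupport_gridSum hℓ s
  have hwt : tsupport w ⊆ openSquare (n * ℓ) := h.tsupport_gridSum_subset hℓ s
  let u' : Plane → ℝ := fun x ↦ u x + a * w x
  have hgrad : ∀ x, gradient u' x = gradient u x + a • gradient w x := fun x ↦ by
    have hwd := hw.differentiable (by simp) x
    simp only [gradient, u']
    rw [fderiv_fun_add (hu.smooth.differentiable (by simp) x) (hwd.const_mul a),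
      fderiv_const_mul hwd, map_add, map_smul]
  have hgradle : ∀ x, ‖gradient u' x‖ ≤ 1 := fun x ↦ by
    rw [hgrad]
    by_cases hx : ∃ i, act i ∧ x ∈ gridCell ℓ i
    · obtain ⟨i, hai, hxi⟩ := hx
      calc _ ≤ ‖gradient u x‖ + a * ‖gradient w x‖ := by
            refine (norm_add_le _ _).trans ?_
            rw [norm_smul, Real.norm_of_nonneg ha0]
        _ ≤ 1 / 2 + 1 / 2 * 1 := by
            gcongr
            · exact hai x hxi
            · exact h.norm_gradient_gridSum_le hℓ hs x
        _ = 1 := by norm_num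
    · have hw0 : gradient w x = 0 := by
        by_cases hx' : ∃ i : Fin 2 → Fin n, x ∈ gridCell ℓ i
        · obtain ⟨i, hi⟩ := hx'
          have hai : ¬ act i := fun hai ↦ hx ⟨i, hai, hi⟩
          rw [h.gradient_gridSum_of_mem hℓ s hi]
          simp [s, hai]
        · exact h.gradient_gridSum_of_notMem hℓ s (not_exists.1 hx')
      rw [hw0, smul_zero, add_zero]
      exact hu.gradient_le x
  refine ⟨u', ⟨⟨hu.smooth.add (contDiff_const.mul hw), ?_, hgradle, ?_⟩, fun x y ↦ ?_, ?_⟩, ?_⟩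
  · refine (tsupport_add u fun x ↦ a * w x).trans (Set.union_subset hu.support_subset ?_)
    exact tsupport_mul_subset_right.trans hwt
  · simp only [u']
    rw [integral_add (hu.smooth.continuous.integrable_of_hasCompactSupport hu.hasCompactSupport)
      ((hw.continuous.integrable_of_hasCompactSupport hwc).const_mul a), integral_const_mul,
      hu.integral_eq_zero, h.integral_gridSum hℓ s]
    simp
  · rw [hgrad, hgrad, add_sub_add_comm, ← smul_sub]
    refine (norm_add_le _ _).trans ?_
    rw [norm_smul, Real.norm_of_nonneg ha0, add_mul, mul_assoc]
    gcongr
    · exact hu.lipschitz x y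
    · exact h.norm_gradient_gridSum_sub_le hB hℓ hs x y
  -- Expanding the square, the cross term costs `2 * a * (2 * L * ℓ) * R ^ 2` by near-orthogonality
  -- and the new scale costs `a ^ 2 * R ^ 2`.
  · have hcross := h.abs_integral_inner_gradient_gridSum_le hℓ hs
      (continuous_gradient hu.smooth) hL0 hu.lipschitz
    have hquad := h.integral_norm_gradient_gridSum_sq_le hℓ hs
    have hi1 := integrable_norm_gradient_sq hu.smooth hu.hasCompactSupport
    have hi2 := integrable_norm_gradient_sq hw hwc
    have hi3 : Integrable fun x ↦ inner ℝ (gradient u x) (gradient w x) :=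
      ((continuous_gradient hu.smooth).inner (continuous_gradient hw)).integrable_of_hasCompactSupport
        ((hasCompactSupport_gradient hwc).mono
          fun x hx hx' ↦ hx (by simp only [hx', inner_zero_right]))
    have hexp : ∀ x, ‖gradient u' x‖ ^ 2 = ‖gradient u x‖ ^ 2 +
        2 * a * inner ℝ (gradient u x) (gradient w x) + a ^ 2 * ‖gradient w x‖ ^ 2 := fun x ↦ by
      rw [hgrad, norm_add_sq_real, inner_smul_right, norm_smul, mul_pow, Real.norm_eq_abs, sq_abs]
      ring
    simp only [hexp]
    have hi4 : Integrable fun x ↦ ‖gradient u x‖ ^ 2 +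
        2 * a * inner ℝ (gradient u x) (gradient w x) := hi1.add (hi3.const_mul _)
    rw [integral_add hi4 (hi2.const_mul _),
      integral_add hi1 (hi3.const_mul _), integral_const_mul, integral_const_mul]
    have h1 := mul_le_mul_of_nonneg_left ((le_abs_self _).trans hcross)
      (by positivity : 0 ≤ 2 * a)
    have h2 := mul_le_mul_of_nonneg_left hquad (by positivity : 0 ≤ a ^ 2)
    have h3 := hu.energy_le
    nlinarith
  · have hbi : ∀ i : Fin 2 → Fin n, Integrable (gridBump φ ℓ i) ν := fun i ↦
      integrable_of_tsupport_subset_openSquare (h.contDiff_gridBump i).continuous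
        ((h.tsupport_gridBump_subset hℓ i).trans (gridCell_subset hℓ i)) hν
    simp only [u']
    rw [integral_add
      (integrable_of_tsupport_subset_openSquare hu.smooth.continuous hu.support_subset hν)
      ((integrable_of_tsupport_subset_openSquare hw.continuous hwt hν).const_mul a),
      integral_const_mul, integral_gridSum_eq_sum s hbi]
    gcongr
    let T : Finset (Fin 2 → Fin n) := Finset.univ.filter fun i ↦ ¬ act i
    have hT := hu.card_mul_sq_le hℓ hL0 hLℓ (T := T) fun i hi ↦ by
      have := (Finset.mem_filter.1 hi).2
      simpa only [act, not_forall, not_le, exists_prop] using this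
    -- On a skipped cell this is Young's inequality, a completed square. On an active cell the
    -- quadratic term is simply given away, so that the sum runs over all cells and no longer
    -- depends on which were skipped.
    have hpt : ∀ i, |Y i| - δ / (2 * ℓ ^ 2) * Y i ^ 2 - (if ¬ act i then ℓ ^ 2 / (2 * δ) else 0) ≤
        s i * Y i := fun i ↦ by
      have hq : 0 ≤ δ / (2 * ℓ ^ 2) * Y i ^ 2 := by positivity
      by_cases hai : act i
      · have : s i * Y i = |Y i| := by
          simp only [s, if_pos hai]
          split_ifs with h0
          · rw [one_mul, abs_of_nonneg h0]
          · rw [neg_one_mul, abs_of_neg (not_le.1 h0)]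
        rw [this]
        simp only [hai, not_true, if_false]
        linarith
      · simp only [s, hai, if_false, not_false_iff, if_true, zero_mul]
        have h5 : 0 ≤ δ / (2 * ℓ ^ 2) * (|Y i| - ℓ ^ 2 / δ) ^ 2 := by positivity
        have h6 : δ / (2 * ℓ ^ 2) * (|Y i| - ℓ ^ 2 / δ) ^ 2 =
            δ / (2 * ℓ ^ 2) * Y i ^ 2 - |Y i| + ℓ ^ 2 / (2 * δ) := by
          rw [← sq_abs (Y i)]
          field_simp
          ring
        linarith
    have hsum := Finset.sum_le_sum fun i (_ : i ∈ Finset.univ) ↦ hpt i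
    rw [Finset.sum_sub_distrib] at hsum
    have hTs : ∑ i, (if ¬ act i then ℓ ^ 2 / (2 * δ) else 0) = T.card * (ℓ ^ 2 / (2 * δ)) := by
      rw [← Finset.sum_filter, Finset.sum_const, nsmul_eq_mul]
    rw [hTs] at hsum
    have hTle : T.card * (ℓ ^ 2 / (2 * δ)) ≤ 8 * A / δ := by
      rw [← mul_div_assoc, div_le_div_iff₀ (by positivity) hδ]
      nlinarith
    linarith

/-! ### Iteration over dyadic scales and expectation -/

/-- The contribution of the `j`-th dyadic scale to the lower bound for the dual supremum. -/
noncomputable def scaleGain (φ : Plane → ℝ) (R δ : ℝ) (j : ℕ) (ν : Measure Plane) : ℝ :=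
  ∑ i : Fin 2 → Fin (2 ^ j), (|∫ x, gridBump φ (R / 2 ^ j) i x ∂ν| -
    δ / (2 * (R / 2 ^ j) ^ 2) * (∫ x, gridBump φ (R / 2 ^ j) i x ∂ν) ^ 2)

namespace IsProfile

variable {φ : Plane → ℝ} {B : ℝ}

/-- The Lipschitz bound doubles at each step: the new scale adds `a * 2 * B / ℓ`, exactly the
current bound `2 * a * B * 2 ^ k / R`. Thus `L * ℓ = 2 * a * B` at every scale, and each step adds
the same energy `a ^ 2 * (8 * B + 1) * R ^ 2`. -/
lemma exists_isControlled (h : IsProfile φ B) (hB : 0 ≤ B) {R a δ : ℝ} (hR : 0 < R) (ha0 : 0 ≤ a)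
    (ha : a ≤ 1 / 2) (haB : 2 * a * B ≤ 1 / 8) (hδ : 0 < δ) {ν : Measure Plane}
    (hν : ν (openSquare R) < ∞) (k : ℕ) :
    ∃ u, IsControlled R (2 * a * B * 2 ^ k / R) (a ^ 2 * k * (8 * B + 1) * R ^ 2) u ∧
      a * ∑ j ∈ Finset.range k,
        (scaleGain φ R δ j ν - 8 * (a ^ 2 * j * (8 * B + 1) * R ^ 2) / δ) ≤ ∫ x, u x ∂ν := by
  induction k with
  | zero =>
    refine ⟨0, isControlled_zero R (by positivity) (by positivity), by simp⟩
  | succ k ih =>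
    obtain ⟨u, hu, hle⟩ := ih
    have hLℓ : 2 * a * B * 2 ^ k / R * (R / 2 ^ k) = 2 * a * B := by field_simp
    obtain ⟨u', hu', hle'⟩ := hu.exists_add_scale h hB (n := 2 ^ k) (ℓ := R / 2 ^ k)
      (by positivity) (by push_cast; field_simp) (by positivity) (hLℓ.trans_le haB) ha0 ha hδ hν
    refine ⟨u', ?_, ?_⟩
    · rw [hLℓ] at hu'
      convert! hu' using 1
      · field_simp
        ring
      · push_cast
        ring
    · rw [Finset.sum_range_succ, mul_add]
      exact (add_le_add_left hle _).trans hle'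

lemma le_dualSup (h : IsProfile φ B) (hB : 0 ≤ B) {R δ : ℝ} (hR : 0 < R) (hδ : 0 < δ)
    (hδ' : δ ≤ 1 / 2) (hδB : 2 * δ * B ≤ 1 / 8) {r : ℕ} (hr : 1 ≤ r) {ν : Measure Plane}
    (hν : ν (openSquare R) < ∞) :
    δ / √r * ∑ j ∈ Finset.range r, (scaleGain φ R δ j ν - 8 * δ * (8 * B + 1) * R ^ 2) ≤
      dualSup R ν := by
  have hr' : (1 : ℝ) ≤ r := by exact_mod_cast hr
  have hsq : 1 ≤ √(r : ℝ) := Real.one_le_sqrt.2 hr'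
  set a := δ / √r with ha
  have ha0 : 0 ≤ a := by positivity
  have haδ : a ≤ δ := div_le_self hδ.le hsq
  obtain ⟨u, hu, hle⟩ := h.exists_isControlled hB hR ha0 (haδ.trans hδ') (by nlinarith) hδ hν r
  refine le_trans ?_ (hle.trans (hu.integral_le_dualSup hν))
  gcongr with j hj
  have hj' : (j : ℝ) ≤ r := by exact_mod_cast (Finset.mem_range.1 hj).le
  -- The amplitude `δ / √r` keeps the energy after any number of at most `r` steps below `δ ^ 2 * (8
  -- * B + 1) * R ^ 2`, so the skipping loss per scale is linear in `δ`.
  have har : a ^ 2 * r = δ ^ 2 := by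
    rw [ha, div_pow, Real.sq_sqrt (by positivity)]
    field_simp
  have : a ^ 2 * j ≤ δ ^ 2 := by rw [← har]; gcongr
  calc 8 * (a ^ 2 * j * (8 * B + 1) * R ^ 2) / δ ≤ 8 * (δ ^ 2 * (8 * B + 1) * R ^ 2) / δ := by
        gcongr
    _ = _ := by field_simp

section Expectation

variable {Ω : Type*} [MeasurableSpace Ω] {P : Measure Ω} [IsProbabilityMeasure P]
  {μ : Ω → Measure Plane}

lemma integrable_scaleGain (h : IsProfile φ B) (hμ : IsUnitPoissonProcess P μ) {R : ℝ}
    (hR : 0 < R) (δ : ℝ) (j : ℕ) : Integrable (fun ω ↦ scaleGain φ R δ j (μ ω)) P :=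
  integrable_finsetSum _ fun i _ ↦ (h.integrable_abs_integral_gridBump hμ (by positivity) i).sub
    ((h.integral_sq_integral_gridBump_le hμ (by positivity) i).1.const_mul _)

/-- There are `(R / ℓ) ^ 2` cells, each contributing order `ℓ ^ 2`, so the bound is the same at
every scale with `ℓ ≥ 1`. -/
lemma le_integral_scaleGain (h : IsProfile φ B) (hμ : IsUnitPoissonProcess P μ) {R : ℝ}
    {δ : ℝ} (hδ : 0 < δ) {j : ℕ} (hj : 2 ^ j ≤ R) :
    R ^ 2 * (1 - Real.exp (-(2 / Real.pi ^ 2 * ∫ x, φ x ^ 2)) -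
      δ * (Real.pi ^ 2 * ∫ x, φ x ^ 2)) ≤ ∫ ω, scaleGain φ R δ j (μ ω) ∂P := by
  have hR : 0 < R := lt_of_lt_of_le (by positivity) hj
  set ℓ := R / 2 ^ j with hℓ
  have hℓ1 : 1 ≤ ℓ := (one_le_div (by positivity)).2 hj
  have hℓ0 : 0 < ℓ := by linarith
  have hRℓ : R = 2 ^ j * ℓ := by rw [hℓ]; field_simp
  set V := ∫ x, φ x ^ 2
  have hV : 0 < V := h.pos
  have h1 := fun i : Fin 2 → Fin (2 ^ j) ↦ h.integrable_abs_integral_gridBump hμ hℓ0 i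
  have h2 := fun i : Fin 2 → Fin (2 ^ j) ↦ h.integral_sq_integral_gridBump_le hμ hℓ0 i
  have h12 : ∀ i : Fin 2 → Fin (2 ^ j), Integrable (fun ω ↦ |∫ x, gridBump φ ℓ i x ∂(μ ω)| -
      δ / (2 * ℓ ^ 2) * (∫ x, gridBump φ ℓ i x ∂(μ ω)) ^ 2) P :=
    fun i ↦ (h1 i).sub ((h2 i).1.const_mul _)
  simp only [scaleGain, ← hℓ]
  rw [integral_finsetSum _ fun i _ ↦ h12 i]
  calc _ = ∑ i : Fin 2 → Fin (2 ^ j), ((1 - Real.exp (-(2 / Real.pi ^ 2 * V))) * ℓ ^ 2 -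
          δ * (Real.pi ^ 2 * V) * ℓ ^ 2) := by
        rw [Finset.sum_const, Finset.card_univ, Fintype.card_fun, Fintype.card_fin,
          Fintype.card_fin, nsmul_eq_mul, hRℓ]
        push_cast
        ring
    _ ≤ _ := by
        refine Finset.sum_le_sum fun i _ ↦ ?_
        rw [integral_sub (h1 i) ((h2 i).1.const_mul _), integral_const_mul]
        have h3 := h.le_integral_abs_integral_gridBump hμ hℓ1 i
        have h4 : δ / (2 * ℓ ^ 2) * ∫ ω, (∫ x, gridBump φ ℓ i x ∂(μ ω)) ^ 2 ∂P ≤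
            δ * (Real.pi ^ 2 * V) * ℓ ^ 2 := by
          calc _ ≤ δ / (2 * ℓ ^ 2) * (Real.pi ^ 2 * (ℓ ^ 4 * V)) := by gcongr; exact (h2 i).2
            _ = δ * (Real.pi ^ 2 * V) * ℓ ^ 2 / 2 := by field_simp
            _ ≤ _ := half_le_self (by positivity)
        linarith

lemma le_integral_dualSup (h : IsProfile φ B) (hB : 0 ≤ B) (hμ : IsUnitPoissonProcess P μ)
    {R δ c : ℝ} (hδ : 0 < δ) (hδ' : δ ≤ 1 / 2) (hδB : 2 * δ * B ≤ 1 / 8)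
    (hc : 1 - Real.exp (-(2 / Real.pi ^ 2 * ∫ x, φ x ^ 2)) = 2 * c)
    (hδc : δ * (Real.pi ^ 2 * (∫ x, φ x ^ 2) + 8 * (8 * B + 1)) ≤ c) {r : ℕ} (hr : 1 ≤ r)
    (hrR : 2 ^ r ≤ R) : δ * c * R ^ 2 * √r ≤ ∫ ω, dualSup R (μ ω) ∂P := by
  have hR : 0 < R := lt_of_lt_of_le (by positivity) hrR
  have hr0 : (0 : ℝ) < r := by exact_mod_cast hr
  have hi : ∀ j, Integrable (fun ω ↦ scaleGain φ R δ j (μ ω) - 8 * δ * (8 * B + 1) * R ^ 2) P :=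
    fun j ↦ (h.integrable_scaleGain hμ hR δ j).sub (integrable_const _)
  have hmono : ∫ ω, δ / √r * ∑ j ∈ Finset.range r,
      (scaleGain φ R δ j (μ ω) - 8 * δ * (8 * B + 1) * R ^ 2) ∂P ≤ ∫ ω, dualSup R (μ ω) ∂P := by
    refine integral_mono_ae ((integrable_finsetSum _ fun j _ ↦ hi j).const_mul _)
      (hμ.integrable_dualSup R) ?_
    filter_upwards [hμ.ae_lt_top (measurableSet_openBox (fun _ ↦ 0) (fun _ ↦ R))
      (volume_openBox_ne_top _ _)] with ω hω
    exact h.le_dualSup hB hR hδ hδ' hδB hr hω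
  refine le_trans ?_ hmono
  rw [integral_const_mul, integral_finsetSum _ fun j _ ↦ hi j]
  calc δ * c * R ^ 2 * √r = δ / √r * ∑ j ∈ Finset.range r, c * R ^ 2 := by
        rw [Finset.sum_const, Finset.card_range, nsmul_eq_mul]
        field_simp
        rw [Real.sq_sqrt hr0.le]
    _ ≤ _ := by
        gcongr with j hj
        rw [integral_sub (h.integrable_scaleGain hμ hR δ j) (integrable_const _),
          integral_const, probReal_univ, one_smul]
        have h1 := h.le_integral_scaleGain hμ hδ (R := R) (j := j)
          ((pow_le_pow_right₀ (by norm_num) (Finset.mem_range.1 hj).le).trans hrR)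
        rw [hc] at h1
        -- The mean gain per scale is `2 * c * R ^ 2` before losses; by `hδc` the Young and skipping
        -- losses consume at most half of it.
        nlinarith [mul_le_mul_of_nonneg_left hδc (sq_nonneg R)]

end Expectation

end IsProfile

/-! ### Choice of constants and conclusion -/

theorem mainTheorem2 :
    ∃ C : ℝ, 0 < C ∧ ∃ R₀ : ℝ, ∀ (Ω : Type*) [MeasurableSpace Ω] (P : Measure Ω)
      [IsProbabilityMeasure P] (μ : Ω → Measure Plane), IsUnitPoissonProcess P μ →
      ∀ R : ℝ, R₀ ≤ R →
        -- almost surely the supremum is a genuine (finite) one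
        (∀ᵐ ω ∂P, BddAbove {s : ℝ | ∃ ζ : Plane → ℝ, IsAdmissible R ζ ∧ s = ∫ x, ζ x ∂(μ ω)}) ∧
        Integrable (fun ω ↦ dualSup R (μ ω)) P ∧
        C * (R ^ 2 * Real.sqrt (Real.log R)) ≤ ∫ ω, dualSup R (μ ω) ∂P := by
  obtain ⟨φ, B, hB, h⟩ := exists_isProfile
  set V := ∫ x, φ x ^ 2 with hVdef
  have hV : 0 < V := h.pos
  set c := (1 - Real.exp (-(2 / Real.pi ^ 2 * V))) / 2 with hc
  have hc0 : 0 < c := by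
    have : Real.exp (-(2 / Real.pi ^ 2 * V)) < 1 := Real.exp_lt_one_iff.2 (by
      rw [neg_lt_zero]; positivity)
    linarith
  set D := Real.pi ^ 2 * V + 8 * (8 * B + 1) with hD
  have hD0 : 0 < D := by positivity
  -- The three bounds ensure, in order, room for the gradient constraint, small oscillation of the
  -- gradient on a cell, and losses of at most half the gain.
  set δ := min (1 / 2) (min (1 / (16 * B)) (c / D)) with hδdef
  have hδ : 0 < δ := by positivity
  have hδ1 : δ ≤ 1 / 2 := min_le_left _ _
  have hδB : 2 * δ * B ≤ 1 / 8 := by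
    have : δ ≤ 1 / (16 * B) := (min_le_right _ _).trans (min_le_left _ _)
    rw [le_div_iff₀ (by positivity)] at this
    linarith
  have hδc : δ * D ≤ c := by
    have : δ ≤ c / D := (min_le_right _ _).trans (min_le_right _ _)
    rwa [le_div_iff₀ hD0] at this
  refine ⟨δ * c / 2, by positivity, Real.exp 1, fun Ω _ P _ μ hμ R hR ↦
    ⟨?_, hμ.integrable_dualSup R, ?_⟩⟩
  · filter_upwards [hμ.ae_lt_top (measurableSet_openBox (fun _ ↦ 0) (fun _ ↦ R))
      (volume_openBox_ne_top _ _)] with ω hω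
    exact bddAbove_admissible hω
  · have hR0 : 0 < R := (Real.exp_pos 1).trans_le hR
    have hlog : 1 ≤ Real.log R := (Real.le_log_iff_exp_le hR0).2 hR
    -- As `2 ≤ e`, this gives `2 ^ r ≤ R`, so all cells used have side at least 1; `R ≥ e` ensures
    -- at least one scale.
    set r := ⌊Real.log R⌋₊ with hr
    have hr1 : 1 ≤ r := Nat.le_floor (by simpa using hlog)
    have hrle : (r : ℝ) ≤ Real.log R := Nat.floor_le (by linarith)
    have hrlt : Real.log R < r + 1 := Nat.lt_floor_add_one _
    have hr1' : (1 : ℝ) ≤ r := by exact_mod_cast hr1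
    have hpow : (2 : ℝ) ^ r ≤ R := by
      calc (2 : ℝ) ^ r ≤ Real.exp 1 ^ r := by
            gcongr; linarith [Real.add_one_le_exp (1 : ℝ)]
        _ = Real.exp r := by rw [← Real.exp_nat_mul, mul_one]
        _ ≤ Real.exp (Real.log R) := Real.exp_le_exp.2 hrle
        _ = R := Real.exp_log hR0
    refine le_trans ?_ (h.le_integral_dualSup hB.le hμ hδ hδ1 hδB (c := c)
      (by rw [hc]; ring) hδc hr1 hpow)
    -- Here `log R < r + 1 ≤ 4 * r`; rounding `log R` down costs the factor 2 in the constant.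
    have hs : √(Real.log R) / 2 ≤ √r := by
      refine Real.le_sqrt_of_sq_le ?_
      rw [div_pow, Real.sq_sqrt (by linarith)]
      linarith
    calc δ * c / 2 * (R ^ 2 * √(Real.log R)) = δ * c * R ^ 2 * (√(Real.log R) / 2) := by ring
      _ ≤ _ := by gcongr
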